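/- An exact symplectic manifold $(U,\lambda)$ is a smooth (Hausdorff, second countable) manifold $U$ without boundary with a smooth $1$-form $\lambda$ such that $d\lambda$ is nondegenerate. Its Liouville field $\mathcal L_\lambda$ is the vector field with $d\lambda(\mathcal L_\lambda,\cdot)=\lambda$, and $\mathcal L_\lambda^t$ denotes the time-$t$ flow of $\mathcal L_\lambda$. It is an open Liouville domain if $\mathcal L_\lambda^t\colon U\to U$ exists for all $t\le 0$ and $\mathcal L_\lambda^t(U)$ has compact closure in $U$ for all $t<0$; then $aU:=\mathcal L_\lambda^{\log a}(U)$ for $0<a\le 1$. A Liouville embedding of $(U,\lambda)$ into $(V,\mu)$ is a smooth embedding $\phi\colon U\to V$ such that $\phi^*\mu-\lambda$ is exact; open subsets carry the restricted $1$-forms. For open Liouville domains $(U,\lambda),(V,\mu)$ of the same dimension $2n$ define the following elements of $[1,\infty]$ (where $\inf\varnothing=\infty$): - $d_c((U,\lambda),(V,\mu))$ is the infimum of all real $a\ge 1$ such that there are Liouville embeddings $a^{-1/2}U\to V$ and $a^{-1/2}V\to U$; - $\delta_f((U,\lambda),(V,\mu))$ is the infimum of all real $a\ge 1$ such that there is a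 Liouville embedding $h\colon a^{-1/2}U\to V$ with $a^{-1}V\subset h(a^{-1/2}U)\subset V$; - $d_f((U,\lambda),(V,\mu))=\max\{\delta_f((U,\lambda),(V,\mu)),\,\delta_f((V,\mu),(U,\lambda))\}$. **Proposition 2.7.** For open Liouville domains $(U,\lambda),(V,\mu),(W,\nu)$ of the same dimension $2n$, 1. $d_c((U,\lambda),(W,\nu))\le d_c((U,\lambda),(V,\mu))\,d_c((V,\mu),(W,\nu))$, 2. $\delta_f((U,\lambda),(W,\nu))\le \delta_f((U,\lambda),(V,\mu))\,\delta_f((V,\mu),(W,\nu))$, 3. $d_f((U,\lambda),(W,\nu))\le d_f((U,\lambda),(V,\mu))\,d_f((V,\mu),(W,\nu))$. -/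

import Mathlib

open scoped Manifold ContDiff Topology ENNReal

noncomputable section

namespace SymplecticBM

/-- Smooth `1`-forms on an `m`-dimensional smooth manifold `M` (without boundary): smooth sections
of the cotangent bundle. -/
abbrev OneForm (m : ℕ) (M : Type*) [TopologicalSpace M]
    [ChartedSpace (EuclideanSpace ℝ (Fin m)) M] [IsManifold (𝓡 m) ∞ M] : Type _ :=
  ContMDiffSection (𝓡 m) (EuclideanSpace ℝ (Fin m) →L[ℝ] ℝ) ∞
    (fun x : M => TangentSpace (𝓡 m) x →L[ℝ] Bundle.Trivial M ℝ x)

section OneManifold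

variable {m : ℕ} {M : Type*} [TopologicalSpace M]
  [ChartedSpace (EuclideanSpace ℝ (Fin m)) M] [IsManifold (𝓡 m) ∞ M]

/-- The value at the tangent vector `v` of the `1`-form `lam`. -/
def OneForm.eval (lam : OneForm m M) (x : M) : TangentSpace (𝓡 m) x →L[ℝ] ℝ := lam x

/-- The `1`-form `lam` written in the chart around `x`: its pullback by the inverse of the
preferred chart at `x`, a `1`-form on (an open subset of) `ℝ^m`. -/
def OneForm.inChart (lam : OneForm m M) (x : M) (y : EuclideanSpace ℝ (Fin m)) :
    EuclideanSpace ℝ (Fin m) →L[ℝ] ℝ :=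
  (lam.eval ((extChartAt (𝓡 m) x).symm y)).comp
    (mfderiv 𝓘(ℝ, EuclideanSpace ℝ (Fin m)) (𝓡 m) (extChartAt (𝓡 m) x).symm y)

/-- The exterior derivative `d lam` at `x`, an alternating bilinear form on `T_x M`: differentiate
the chart expression of `lam` around `x`, and transport the result back along the chart. (The
exterior derivative commutes with pullbacks, so the choice of the chart is immaterial.) -/
def OneForm.d (lam : OneForm m M) (x : M) : TangentSpace (𝓡 m) x [⋀^Fin 2]→L[ℝ] ℝ :=
  (extDeriv (fun y => ContinuousAlternatingMap.ofSubsingleton ℝ (EuclideanSpace ℝ (Fin m)) ℝ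
      (0 : Fin 1) (lam.inChart x y)) (extChartAt (𝓡 m) x x)).compContinuousLinearMap
    (mfderiv (𝓡 m) 𝓘(ℝ, EuclideanSpace ℝ (Fin m)) (extChartAt (𝓡 m) x) x)

/-- `(M, lam)` is an exact symplectic manifold: the closed `2`-form `d lam` is nondegenerate. -/
def IsExactSymplectic (lam : OneForm m M) : Prop :=
  ∀ (x : M) (v : TangentSpace (𝓡 m) x),
    (∀ w : TangentSpace (𝓡 m) x, lam.d x ![v, w] = 0) → v = 0

/-- The Liouville vector field of `lam`: the vector field `L` with `d lam (L, ·) = lam`. It exists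
and is unique when `d lam` is nondegenerate, see `liouvilleField_spec`, `liouvilleField_unique`. -/
def liouvilleField (lam : OneForm m M) (x : M) : TangentSpace (𝓡 m) x :=
  Classical.epsilon fun v => ∀ w : TangentSpace (𝓡 m) x, lam.d x ![v, w] = lam.eval x w

theorem d_add_left (lam : OneForm m M) (x : M) (u v w : TangentSpace (𝓡 m) x) :
    lam.d x ![u + v, w] = lam.d x ![u, w] + lam.d x ![v, w] :=
  (lam.d x).toMultilinearMap.cons_add ![w] u v

theorem d_smul_left (lam : OneForm m M) (x : M) (c : ℝ) (v w : TangentSpace (𝓡 m) x) :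
    lam.d x ![c • v, w] = c * lam.d x ![v, w] :=
  (lam.d x).toMultilinearMap.cons_smul ![w] c v

theorem d_swap (lam : OneForm m M) (x : M) (v w : TangentSpace (𝓡 m) x) :
    lam.d x ![v, w] = - lam.d x ![w, v] := by
  have h := (lam.d x).toAlternatingMap.map_swap ![w, v] (i := 0) (j := 1) (by decide)
  have e : (![w, v] : Fin 2 → TangentSpace (𝓡 m) x) ∘ Equiv.swap (0 : Fin 2) 1 = ![v, w] := by
    funext i; fin_cases i <;> simp
  rw [e] at h
  exact h

theorem liouvilleField_spec {lam : OneForm m M} (h : IsExactSymplectic lam) (x : M)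
    (w : TangentSpace (𝓡 m) x) : lam.d x ![liouvilleField lam x, w] = lam.eval x w := by
  have key : ∃ v : TangentSpace (𝓡 m) x,
      ∀ w : TangentSpace (𝓡 m) x, lam.d x ![v, w] = lam.eval x w := by
    have : FiniteDimensional ℝ (TangentSpace (𝓡 m) x) :=
      inferInstanceAs (FiniteDimensional ℝ (EuclideanSpace ℝ (Fin m)))
    let T : TangentSpace (𝓡 m) x →ₗ[ℝ] Module.Dual ℝ (TangentSpace (𝓡 m) x) :=
      LinearMap.mk₂ ℝ (fun v w => lam.d x ![v, w])
        (fun u v w => d_add_left lam x u v w)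
        (fun c v w => d_smul_left lam x c v w)
        (fun u v w => by
          rw [d_swap, d_add_left, neg_add, ← d_swap, ← d_swap])
        (fun c v w => by
          rw [d_swap, d_smul_left, d_swap lam x v w, smul_eq_mul, mul_neg])
    have hinj : Function.Injective T := by
      rw [← LinearMap.ker_eq_bot, LinearMap.ker_eq_bot']
      intro v hv
      exact h x v fun w => LinearMap.congr_fun hv w
    have hsurj : Function.Surjective T :=
      (LinearMap.injective_iff_surjective_of_finrank_eq_finrank
        Subspace.dual_finrank_eq.symm).1 hinj
    obtain ⟨v, hv⟩ := hsurj (lam.eval x).toLinearMap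
    exact ⟨v, fun w => LinearMap.congr_fun hv w⟩
  exact Classical.epsilon_spec key w

theorem liouvilleField_unique {lam : OneForm m M} (h : IsExactSymplectic lam) (x : M)
    (v : TangentSpace (𝓡 m) x)
    (hv : ∀ w : TangentSpace (𝓡 m) x, lam.d x ![v, w] = lam.eval x w) :
    v = liouvilleField lam x := by
  rw [← sub_eq_zero]
  refine h x _ fun w => ?_
  have e : v - liouvilleField lam x = v + (-1 : ℝ) • liouvilleField lam x := by
    rw [neg_one_smul, sub_eq_add_neg]
  rw [e, d_add_left, d_smul_left, hv, liouvilleField_spec h]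
  ring

/-- For `t ≤ 0`: the time-`t` Liouville flow is defined at `x` and takes `x` to `y`, that is, an
integral curve of the Liouville field over `[t, 0]` has value `x` at time `0` and `y` at time `t`.
(Integral curves being unique, there is at most one such `y`.) -/
def FlowsTo (lam : OneForm m M) (t : ℝ) (x y : M) : Prop :=
  ∃ γ : ℝ → M, γ 0 = x ∧ γ t = y ∧
    IsMIntegralCurveOn (I := 𝓡 m) γ (liouvilleField lam) (Set.Icc t 0)

/-- The image of `M` under the time-`t` Liouville flow, `t ≤ 0`. -/
def flowImage (lam : OneForm m M) (t : ℝ) : Set M := {y | ∃ x, FlowsTo lam t x y}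

/-- `(M, lam)` is an open Liouville domain. -/
structure IsOpenLiouvilleDomain (lam : OneForm m M) : Prop where
  /-- `(M, lam)` is an exact symplectic manifold. -/
  exactSymplectic : IsExactSymplectic lam
  /-- The Liouville flow exists on all of `M` for all nonpositive times. -/
  flow_exists : ∀ t : ℝ, t ≤ 0 → ∀ x : M, ∃ y : M, FlowsTo lam t x y
  /-- For `t < 0` the image of `M` under the time-`t` flow has compact closure in `M`. -/
  isCompact_closure : ∀ t : ℝ, t < 0 → IsCompact (closure (flowImage lam t))

/-- The scaling `a M`, for `0 < a ≤ 1`: the image of `M` under the time-`log a` Liouville flow. -/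
def scaling (a : ℝ) (lam : OneForm m M) : Set M := flowImage lam (Real.log a)

end OneManifold

section Distances

variable {n : ℕ}
  {U : Type*} [TopologicalSpace U] [ChartedSpace (EuclideanSpace ℝ (Fin (2 * n))) U]
  [IsManifold (𝓡 (2 * n)) ∞ U]
  {V : Type*} [TopologicalSpace V] [ChartedSpace (EuclideanSpace ℝ (Fin (2 * n))) V]
  [IsManifold (𝓡 (2 * n)) ∞ V]

/-- `h` restricts to a Liouville embedding `(S, lam) ↪ (V, mu)` of the open subset `S` of `U`: it is
a smooth embedding of `S` (a smooth immersion that is a homeomorphism onto its image), and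
`h^* mu - lam = df` on `S` for some smooth function `f` on `S`. The values of `h` and `f` outside
`S` are irrelevant. -/
structure IsLiouvilleEmbeddingOn (lam : OneForm (2 * n) U) (mu : OneForm (2 * n) V) (S : Set U)
    (h : U → V) : Prop where
  contMDiffOn : ContMDiffOn (𝓡 (2 * n)) (𝓡 (2 * n)) ∞ h S
  isEmbedding : Topology.IsEmbedding (S.domRestrict h)
  injective_mfderiv : ∀ x ∈ S, Function.Injective (mfderiv (𝓡 (2 * n)) (𝓡 (2 * n)) h x)
  exact_sub : ∃ f : U → ℝ, ContMDiffOn (𝓡 (2 * n)) 𝓘(ℝ, ℝ) ∞ f S ∧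
    ∀ x ∈ S, ∀ v : TangentSpace (𝓡 (2 * n)) x,
      mu.eval (h x) (mfderiv (𝓡 (2 * n)) (𝓡 (2 * n)) h x v) - lam.eval x v =
        mfderiv (𝓡 (2 * n)) 𝓘(ℝ, ℝ) f x v

/-- The coarse symplectic Banach-Mazur distance, with values in `[1, ∞]`: the infimum of all
`a ≥ 1` such that there are Liouville embeddings of `a^{-1/2} U` into `V` and of `a^{-1/2} V`
into `U`. -/
def coarseDist (lam : OneForm (2 * n) U) (mu : OneForm (2 * n) V) : ℝ≥0∞ :=
  sInf {r | ∃ a : ℝ, 1 ≤ a ∧ r = ENNReal.ofReal a ∧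
    (∃ h : U → V, IsLiouvilleEmbeddingOn lam mu (scaling (a ^ (-1 / 2 : ℝ)) lam) h) ∧
    (∃ k : V → U, IsLiouvilleEmbeddingOn mu lam (scaling (a ^ (-1 / 2 : ℝ)) mu) k)}

/-- The fine symplectic Banach-Mazur hemidistance, with values in `[1, ∞]`: the infimum of all
`a ≥ 1` such that there is a Liouville embedding of `a^{-1/2} U` into `V` whose image contains
`a^{-1} V`. -/
def fineHemidist (lam : OneForm (2 * n) U) (mu : OneForm (2 * n) V) : ℝ≥0∞ :=
  sInf {r | ∃ a : ℝ, 1 ≤ a ∧ r = ENNReal.ofReal a ∧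
    ∃ h : U → V, IsLiouvilleEmbeddingOn lam mu (scaling (a ^ (-1 / 2 : ℝ)) lam) h ∧
      scaling a⁻¹ mu ⊆ h '' scaling (a ^ (-1 / 2 : ℝ)) lam}

/-- The fine symplectic Banach-Mazur distance. -/
def fineDist (lam : OneForm (2 * n) U) (mu : OneForm (2 * n) V) : ℝ≥0∞ :=
  max (fineHemidist lam mu) (fineHemidist mu lam)

end Distances

end SymplecticBM

end

noncomputable section

namespace SymplecticBM

open Set Filter

section

/-! ### Grönwall estimates for times in `(-1, 1)` -/

section Gronwall

variable {F : Type*} [NormedAddCommGroup F] [NormedSpace ℝ F]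

/-! The Liouville flow multiplies the `1`-form by `exp t`. Hence, if `F` is a Liouville embedding of
a scaling of `U` into `V`, so is its conjugate: flow `U` for time `s`, apply `F`, flow `V` for time
`-s`. The conjugate is defined on a smaller scaling of `U` and lands in `flowImage mu (-s)`
(`IsLiouvilleEmbeddingOn.exists_conj_flow`, `IsLiouvilleEmbeddingOn.exists_shrink`). Choosing `s` to
be half the logarithm of `b` puts the image inside the domain `b^{-1/2} V` of the second embedding
`K`; composing the two gives the coarse inequality.

The fine inequality also needs the composite to cover a scaling of `W`. The conjugate of `F` covers
a small scaling of `V`, so `K` should send small scalings of `V` to sets containing small scalings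
of `W`. This would be automatic if `K` intertwined the Liouville flows, but the pullback of `nu` by
`K` is only `mu + df`. What `K` does is carry the Liouville field of `mu` to that of `nu - dg`,
wherever `g` agrees with `f` transported by `K`. Such a `g` with compact support exists after an
arbitrarily small shrinking. Let `Φ` be the flow of `nu - dg` for time `t` followed by the flow of
`nu` for time `-t`. The factors `exp t` and `exp (-t)` cancel, so `Φ` is a Liouville embedding of
`W` into itself. Moreover `Φ ∘ K` takes the time `-t` flow of `p` to the time `-t` flow of `K p`, so
the covering property of `K` moves down by `t` (`IsLiouvilleEmbeddingOn.exists_extension`). The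
shrinking costs an `ε` that vanishes in the infimum.

The forward flow of `nu - dg` need not exist up to time `t`. However, the support of `g` lies in
some `flowImage nu (-s)`, whose complement is forward invariant under the flow of `nu`; there the
two flows agree and cancel in `Φ`. An orbit may therefore be stopped once it has left, without
changing the value of `Φ` (`exists_flow_comp_flow`).

Underneath lie the smoothness of flows (variational equation and Grönwall), the naturality of `d` in
charts, and Cartan's identity, which gives the factor `exp t` (`exists_local_flow`). -/

theorem norm_le_of_gronwall_right {u u' : ℝ → F} {K δ ε : ℝ} (hK : 0 ≤ K) (hδ : 0 ≤ δ)
    (hε : 0 ≤ ε) (hu : ∀ t ∈ Ioo (-1 : ℝ) 1, HasDerivAt u (u' t) t) (h0 : ‖u 0‖ ≤ δ)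
    (hb : ∀ t ∈ Ioo (-1 : ℝ) 1, ‖u' t‖ ≤ K * ‖u t‖ + ε) {t : ℝ} (ht : t ∈ Ico (0 : ℝ) 1) :
    ‖u t‖ ≤ (δ + ε) * Real.exp (K + 1) := by
  have hsub : Icc 0 t ⊆ Ioo (-1 : ℝ) 1 := fun s hs => ⟨by linarith [hs.1], by linarith [hs.2, ht.2]⟩
  -- Using `K + 1` in place of `K` avoids the separate formula for `gronwallBound` at constant zero.
  have h := norm_le_gronwallBound_of_norm_deriv_right_le (f := u) (f' := u') (δ := δ)
    (K := K + 1) (ε := ε) (a := 0) (b := t)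
    (fun s hs => (hu s (hsub hs)).continuousAt.continuousWithinAt)
    (fun s hs => (hu s (hsub (Ico_subset_Icc_self hs))).hasDerivWithinAt) h0
    (fun s hs => (hb s (hsub (Ico_subset_Icc_self hs))).trans (by nlinarith [norm_nonneg (u s)]))
    t ⟨ht.1, le_rfl⟩
  rw [gronwallBound_of_K_ne_0 (by positivity)] at h
  have e1 : Real.exp ((K + 1) * (t - 0)) ≤ Real.exp (K + 1) :=
    Real.exp_le_exp.2 (by nlinarith [ht.2])
  have e2 : (1 : ℝ) ≤ Real.exp ((K + 1) * (t - 0)) := Real.one_le_exp (by nlinarith [ht.1])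
  have e3 : ε / (K + 1) ≤ ε := div_le_self hε (by linarith)
  have e4 : 0 ≤ ε / (K + 1) := by positivity
  calc ‖u t‖ ≤ _ := h
    _ ≤ δ * Real.exp (K + 1) + ε * Real.exp (K + 1) := by
        have e5 := mul_le_mul_of_nonneg_left e1 hδ
        have e6 : ε / (K + 1) * (Real.exp ((K + 1) * (t - 0)) - 1) ≤ ε * Real.exp (K + 1) :=
          mul_le_mul e3 (by linarith) (by linarith) hε
        exact add_le_add e5 e6
    _ = _ := by ring

/-- A two-sided Grönwall inequality on the interval `(-1, 1)`. -/
theorem norm_le_of_gronwall {u u' : ℝ → F} {K δ ε : ℝ} (hK : 0 ≤ K) (hδ : 0 ≤ δ)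
    (hε : 0 ≤ ε) (hu : ∀ t ∈ Ioo (-1 : ℝ) 1, HasDerivAt u (u' t) t) (h0 : ‖u 0‖ ≤ δ)
    (hb : ∀ t ∈ Ioo (-1 : ℝ) 1, ‖u' t‖ ≤ K * ‖u t‖ + ε) {t : ℝ} (ht : t ∈ Ioo (-1 : ℝ) 1) :
    ‖u t‖ ≤ (δ + ε) * Real.exp (K + 1) := by
  rcases le_total 0 t with h | h
  · exact norm_le_of_gronwall_right hK hδ hε hu h0 hb ⟨h, ht.2⟩
  · have hn : ∀ s ∈ Ioo (-1 : ℝ) 1, -s ∈ Ioo (-1 : ℝ) 1 := fun s hs =>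
      ⟨by linarith [hs.2], by linarith [hs.1]⟩
    have := norm_le_of_gronwall_right (u := fun s => u (-s)) (u' := fun s => -u' (-s)) hK hδ hε
      (fun s hs => by
        have := (hu (-s) (hn s hs)).scomp s (hasDerivAt_neg s)
        simpa using! this)
      (by simpa using h0) (fun s hs => by simpa using hb (-s) (hn s hs))
      (t := -t) ⟨by linarith, by linarith [ht.1]⟩
    simpa using this

end Gronwall

/-! ### Smoothness of the flow of a compactly supported field -/

section Flow

universe u

variable {E : Type u} [NormedAddCommGroup E] [NormedSpace ℝ E]

/-- `φ` is the flow of the vector field `f` for times in `(-1, 1)`. -/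
structure IsUnitFlow (f : E → E) (φ : ℝ → E → E) : Prop where
  zero : ∀ x, φ 0 x = x
  hasDerivAt : ∀ x, ∀ t ∈ Ioo (-1 : ℝ) 1, HasDerivAt (fun s => φ s x) (f (φ t x)) t

theorem exists_isUnitFlow [CompleteSpace E] {f : E → E} {K C : NNReal} (hf : LipschitzWith K f)
    (hC : ∀ x, ‖f x‖ ≤ C) : ∃ φ, IsUnitFlow f φ := by
  have h : ∀ x : E, ∃ α : ℝ → E, α 0 = x ∧ ∀ t ∈ Ioo (-1 : ℝ) 1, HasDerivAt α (f (α t)) t := by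
    intro x
    -- As `f` is bounded by `C`, a solution stays within distance `C` of `x` for all times in `[-1,
    -- 1]`.
    have hp : IsPicardLindelof (fun _ => f) (tmin := -1) (tmax := 1) ⟨0, by simp⟩ x C 0 C K :=
      { lipschitzOnWith := fun t _ => hf.lipschitzOnWith
        continuousOn := fun x _ => continuousOn_const
        norm_le := fun t _ x _ => hC x
        mul_max_le := by simp }
    obtain ⟨α, h0, hα⟩ := hp.exists_eq_forall_mem_Icc_hasDerivWithinAt₀
    exact ⟨α, h0, fun t ht => (hα t (Ioo_subset_Icc_self ht)).hasDerivAt (Icc_mem_nhds ht.1 ht.2)⟩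
  choose α h0 hα using h
  exact ⟨fun t x => α x t, h0, hα⟩

theorem curve_dist_le {f : E → E} {K : NNReal} (hf : LipschitzWith K f) {α β : ℝ → E}
    (hα : ∀ t ∈ Ioo (-1 : ℝ) 1, HasDerivAt α (f (α t)) t)
    (hβ : ∀ t ∈ Ioo (-1 : ℝ) 1, HasDerivAt β (f (β t)) t) {t : ℝ} (ht : t ∈ Ioo (-1 : ℝ) 1) :
    ‖α t - β t‖ ≤ ‖α 0 - β 0‖ * Real.exp (K + 1) := by
  have := norm_le_of_gronwall (u := fun t => α t - β t) (u' := fun t => f (α t) - f (β t))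
    (K := K) (δ := ‖α 0 - β 0‖) (ε := 0) K.2 (norm_nonneg _) le_rfl
    (fun t ht => (hα t ht).sub (hβ t ht)) le_rfl
    (fun t _ => by simpa using hf.norm_sub_le (α t) (β t)) ht
  simpa using this

theorem IsUnitFlow.eq_of_hasDerivAt {f : E → E} {φ : ℝ → E → E} (hφ : IsUnitFlow f φ) {K : NNReal}
    (hf : LipschitzWith K f) {α : ℝ → E}
    (hα : ∀ t ∈ Ioo (-1 : ℝ) 1, HasDerivAt α (f (α t)) t) {t : ℝ} (ht : t ∈ Ioo (-1 : ℝ) 1) :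
    α t = φ t (α 0) := by
  have := curve_dist_le hf hα (hφ.hasDerivAt (α 0)) ht
  rw [hφ.zero, sub_self, norm_zero, zero_mul] at this
  exact sub_eq_zero.1 (norm_le_zero_iff.1 this)

theorem IsUnitFlow.norm_sub_le {f : E → E} {φ : ℝ → E → E} (hφ : IsUnitFlow f φ) {K : NNReal}
    (hf : LipschitzWith K f) (x y : E) {t : ℝ} (ht : t ∈ Ioo (-1 : ℝ) 1) :
    ‖φ t x - φ t y‖ ≤ ‖x - y‖ * Real.exp (K + 1) := by
  have := curve_dist_le hf (hφ.hasDerivAt x) (hφ.hasDerivAt y) ht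
  rwa [hφ.zero, hφ.zero] at this

theorem IsUnitFlow.continuous {f : E → E} {φ : ℝ → E → E} (hφ : IsUnitFlow f φ) {K : NNReal}
    (hf : LipschitzWith K f) {t : ℝ} (ht : t ∈ Ioo (-1 : ℝ) 1) : Continuous (φ t) := by
  refine (LipschitzWith.of_dist_le_mul (K := ⟨Real.exp (K + 1), (Real.exp_pos _).le⟩)
    fun x y => ?_).continuous
  rw [dist_eq_norm, dist_eq_norm, mul_comm]
  exact hφ.norm_sub_le hf x y ht

theorem norm_taylor_one_le {f : E → E} (hf : Differentiable ℝ f) {K : NNReal}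
    (hK : LipschitzWith K (fderiv ℝ f)) (a b : E) :
    ‖f b - f a - fderiv ℝ f a (b - a)‖ ≤ K * ‖b - a‖ * ‖b - a‖ := by
  refine (convex_segment a b).norm_image_sub_le_of_norm_hasFDerivWithin_le'
    (f' := fderiv ℝ f) (fun x _ => (hf x).hasFDerivAt.hasFDerivWithinAt) (fun x hx => ?_)
    (left_mem_segment ℝ a b) (right_mem_segment ℝ a b)
  refine (hK.norm_sub_le x a).trans ?_
  gcongr
  obtain ⟨θ, hθ, rfl⟩ := (segment_eq_image' ℝ a b ▸ hx)
  simp only [add_sub_cancel_left, norm_smul, Real.norm_eq_abs, abs_of_nonneg hθ.1]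
  exact mul_le_of_le_one_left (norm_nonneg _) hθ.2

/-- `A` solves the variational equation along the flow `φ` of `f`. -/
structure IsVariation (f : E → E) (φ : ℝ → E → E) (A : ℝ → E → (E →L[ℝ] E)) : Prop where
  zero : ∀ x, A 0 x = ContinuousLinearMap.id ℝ E
  hasDerivAt : ∀ x, ∀ t ∈ Ioo (-1 : ℝ) 1,
    HasDerivAt (fun s => A s x) ((fderiv ℝ f (φ t x)).comp (A t x)) t

/-- The Taylor remainder of `φ t` at `x` vanishes at time zero and satisfies a linear differential
inequality with error quadratic in `h`; Grönwall then bounds it by a multiple of `‖h‖ ^ 2`. -/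
theorem IsVariation.hasFDerivAt {f : E → E} {φ : ℝ → E → E} {A : ℝ → E → (E →L[ℝ] E)}
    (hA : IsVariation f φ A) (hφ : IsUnitFlow f φ) (hd : Differentiable ℝ f) {K K₂ : NNReal}
    (hf : LipschitzWith K f) (hK : LipschitzWith K₂ (fderiv ℝ f)) (x : E) {t : ℝ}
    (ht : t ∈ Ioo (-1 : ℝ) 1) : HasFDerivAt (φ t) (A t x) x := by
  set C : ℝ := Real.exp (K + 1) with hC
  have key : ∀ h : E, ‖φ t (x + h) - φ t x - A t x h‖ ≤ K₂ * C ^ 3 * ‖h‖ ^ 2 := by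
    intro h
    have hε : (0 : ℝ) ≤ K₂ * C ^ 2 * ‖h‖ ^ 2 := by positivity
    have := norm_le_of_gronwall (u := fun s => φ s (x + h) - φ s x - A s x h)
      (u' := fun s => f (φ s (x + h)) - f (φ s x) - (fderiv ℝ f (φ s x)) (A s x h))
      (K := K) (δ := 0) (ε := K₂ * C ^ 2 * ‖h‖ ^ 2) K.2 le_rfl hε
      (fun s hs => ((hφ.hasDerivAt _ s hs).sub (hφ.hasDerivAt _ s hs)).sub
        ((hA.hasDerivAt x s hs).clm_apply (hasDerivAt_const s h) |>.congr_deriv (by simp)))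
      (by simp [hφ.zero, hA.zero]) (fun s hs => ?_) ht
    · calc _ ≤ _ := this
        _ = _ := by rw [← hC]; ring
    · have e1 := norm_taylor_one_le hd hK (φ s x) (φ s (x + h))
      have e2 : ‖φ s (x + h) - φ s x‖ ≤ ‖h‖ * C := by
        simpa using hφ.norm_sub_le hf (x + h) x hs
      have e3 : ‖fderiv ℝ f (φ s x)‖ ≤ K := norm_fderiv_le_of_lipschitz ℝ hf
      have e4 : f (φ s (x + h)) - f (φ s x) - (fderiv ℝ f (φ s x)) (A s x h) =
          (f (φ s (x + h)) - f (φ s x) - fderiv ℝ f (φ s x) (φ s (x + h) - φ s x)) +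
          fderiv ℝ f (φ s x) (φ s (x + h) - φ s x - A s x h) := by
        simp only [map_sub]; abel
      rw [e4]
      refine (norm_add_le _ _).trans ?_
      rw [add_comm]
      refine add_le_add ((fderiv ℝ f (φ s x)).le_of_opNorm_le e3 _) (e1.trans ?_)
      calc K₂ * ‖φ s (x + h) - φ s x‖ * ‖φ s (x + h) - φ s x‖
          ≤ K₂ * (‖h‖ * C) * (‖h‖ * C) := by gcongr
        _ = _ := by ring
  rw [hasFDerivAt_iff_isLittleO_nhds_zero]
  have h1 : (fun h : E => φ t (x + h) - φ t x - A t x h) =O[𝓝 0] fun h => ‖h‖ ^ 2 :=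
    Asymptotics.IsBigO.of_bound (K₂ * C ^ 3) (Eventually.of_forall fun h => by
      simpa using key h)
  exact h1.trans_isLittleO (by simpa using Asymptotics.isLittleO_norm_pow_id (E' := E) one_lt_two)

theorem exists_lipschitz_bounded {F : Type*} [NormedAddCommGroup F] [NormedSpace ℝ F]
    {f : E → F} (hf : ContDiff ℝ ∞ f) (hc : HasCompactSupport f) :
    ∃ K C : NNReal, LipschitzWith K f ∧ ∀ x, ‖f x‖ ≤ C := by
  obtain ⟨K, hK⟩ := (hf.of_le (by exact_mod_cast le_top : (1 : WithTop ℕ∞) ≤ _)).lipschitzWith_of_hasCompactSupport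
    hc one_ne_zero
  obtain ⟨C, hC⟩ := hc.exists_bound_of_continuous hf.continuous
  exact ⟨K, C.toNNReal, hK, fun x => (hC x).trans (Real.le_coe_toNNReal C)⟩

/-- The flow of `f` lifted to the derivative: a compactly supported smooth field on `E × End E`
whose flow, started at `(x, id)`, gives the solution of the variational equation. -/
theorem exists_variational_field [FiniteDimensional ℝ E] {f : E → E} (hf : ContDiff ℝ ∞ f)
    (hc : HasCompactSupport f) {φ : ℝ → E → E} (hφ : IsUnitFlow f φ) :
    ∃ (F : E × (E →L[ℝ] E) → E × (E →L[ℝ] E)) (Φ : ℝ → E × (E →L[ℝ] E) → E × (E →L[ℝ] E)),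
      ContDiff ℝ ∞ F ∧ HasCompactSupport F ∧ IsUnitFlow F Φ ∧
      IsVariation f φ (fun t x => (Φ t (x, ContinuousLinearMap.id ℝ E)).2) := by
  obtain ⟨K, C, hK, -⟩ := exists_lipschitz_bounded hf hc
  set R : ℝ := (‖ContinuousLinearMap.id ℝ E‖ + 0) * Real.exp (K + 1) + 1 with hR
  have hR0 : 0 < R := by positivity
  let χ : ContDiffBump (0 : E →L[ℝ] E) := ⟨R, R + 1, hR0, by linarith⟩
  -- The field `(f, Df ∘ A)` is not compactly supported in `A`. The cutoff repairs this, and `R` is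
  -- large enough for orbits starting at `(x, id)` never to meet it.
  let F : E × (E →L[ℝ] E) → E × (E →L[ℝ] E) := fun p =>
    χ p.2 • (f p.1, (fderiv ℝ f p.1).comp p.2)
  have hfd : ContDiff ℝ ∞ (fderiv ℝ f) := hf.fderiv_right (by simp)
  have hF : ContDiff ℝ ∞ F := by
    refine (χ.contDiff.comp contDiff_snd).smul ((hf.comp contDiff_fst).prodMk ?_)
    exact (hfd.comp contDiff_fst).clm_comp contDiff_snd
  have hFc : HasCompactSupport F := by
    refine HasCompactSupport.intro (K := tsupport f ×ˢ tsupport χ) (hc.isCompact.prod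
      χ.hasCompactSupport.isCompact) fun p hp => ?_
    by_cases h2 : p.2 ∈ tsupport χ
    · have h1 : p.1 ∉ tsupport f := fun h1 => hp ⟨h1, h2⟩
      have h3 : fderiv ℝ f p.1 = 0 :=
        image_eq_zero_of_notMem_tsupport fun h => h1 (tsupport_fderiv_subset ℝ h)
      simp [F, image_eq_zero_of_notMem_tsupport h1, h3]
    · simp [F, image_eq_zero_of_notMem_tsupport h2]
  obtain ⟨K', C', hK', hC'⟩ := exists_lipschitz_bounded hF hFc
  obtain ⟨Φ, hΦ⟩ := exists_isUnitFlow hK' hC'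
  refine ⟨F, Φ, hF, hFc, hΦ, fun x => by rw [hΦ.zero], fun x => ?_⟩
  set p : E × (E →L[ℝ] E) := (x, ContinuousLinearMap.id ℝ E) with hp
  have hd : ∀ t ∈ Ioo (-1 : ℝ) 1, HasDerivAt (fun s => (Φ s p).2)
      (χ (Φ t p).2 • (fderiv ℝ f (Φ t p).1).comp (Φ t p).2) t := fun t ht =>
    (hΦ.hasDerivAt p t ht).snd
  have hd1 : ∀ t ∈ Ioo (-1 : ℝ) 1, HasDerivAt (fun s => (Φ s p).1)
      (χ (Φ t p).2 • f (Φ t p).1) t := fun t ht => (hΦ.hasDerivAt p t ht).fst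
  have hχ : ∀ t ∈ Ioo (-1 : ℝ) 1, χ (Φ t p).2 = 1 := by
    intro t ht
    apply χ.one_of_mem_closedBall
    rw [mem_closedBall_zero_iff]
    have := norm_le_of_gronwall (K := K) K.2 (norm_nonneg (ContinuousLinearMap.id ℝ E)) le_rfl hd
      (by rw [hΦ.zero]) (fun s hs => ?_) ht
    · exact this.trans (by change _ ≤ R; rw [hR]; linarith)
    · rw [norm_smul, Real.norm_eq_abs, abs_of_nonneg χ.nonneg, add_zero]
      refine (mul_le_of_le_one_left (norm_nonneg _) χ.le_one).trans ?_
      refine (ContinuousLinearMap.opNorm_comp_le _ _).trans ?_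
      gcongr
      exact norm_fderiv_le_of_lipschitz ℝ hK
  have heq : ∀ t ∈ Ioo (-1 : ℝ) 1, (Φ t p).1 = φ t x := by
    intro t ht
    have := hφ.eq_of_hasDerivAt hK (α := fun s => (Φ s p).1)
      (fun s hs => by simpa [hχ s hs] using hd1 s hs) ht
    simpa [hΦ.zero] using this
  intro t ht
  have := hd t ht
  rwa [hχ t ht, one_smul, heq t ht] at this

/-- The derivative of the flow is a component of the flow of another compactly supported smooth
field, on `E × End E`. The induction therefore has to range over all spaces `E`. -/
theorem IsUnitFlow.contDiff_nat (n : ℕ) : ∀ {E : Type u} [NormedAddCommGroup E] [NormedSpace ℝ E]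
    [FiniteDimensional ℝ E] {f : E → E} {φ : ℝ → E → E}, ContDiff ℝ ∞ f → HasCompactSupport f →
    IsUnitFlow f φ → ∀ t ∈ Ioo (-1 : ℝ) 1, ContDiff ℝ n (φ t) := by
  induction n with
  | zero =>
    intro E _ _ _ f φ hf hc hφ t ht
    obtain ⟨K, C, hK, -⟩ := exists_lipschitz_bounded hf hc
    exact contDiff_zero.2 (hφ.continuous hK ht)
  | succ n ih =>
    intro E _ _ _ f φ hf hc hφ t ht
    obtain ⟨F, Φ, hF, hFc, hΦ, hA⟩ := exists_variational_field hf hc hφ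
    obtain ⟨K, C, hK, -⟩ := exists_lipschitz_bounded hf hc
    have hfd : ContDiff ℝ ∞ (fderiv ℝ f) := hf.fderiv_right (by simp)
    obtain ⟨K₂, C₂, hK₂, -⟩ := exists_lipschitz_bounded hfd (hc.fderiv ℝ)
    have hD := fun x => hA.hasFDerivAt hφ (hf.differentiable (by simp)) hK hK₂ x ht
    refine contDiff_succ_iff_hasFDerivAt.2 ⟨_, ?_, hD⟩
    exact contDiff_snd.comp ((ih hF hFc hΦ t ht).comp (contDiff_id.prodMk contDiff_const))

/-- The flow of a compactly supported smooth vector field is smooth, and its derivative solves the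
variational equation. -/
theorem exists_smooth_unitFlow [FiniteDimensional ℝ E] {f : E → E} (hf : ContDiff ℝ ∞ f)
    (hc : HasCompactSupport f) : ∃ φ : ℝ → E → E, IsUnitFlow f φ ∧
      (∀ t ∈ Ioo (-1 : ℝ) 1, ContDiff ℝ ∞ (φ t)) ∧
      ∀ x, fderiv ℝ (φ 0) x = ContinuousLinearMap.id ℝ E ∧ ∀ t ∈ Ioo (-1 : ℝ) 1,
        HasDerivAt (fun s => fderiv ℝ (φ s) x)
          ((fderiv ℝ f (φ t x)).comp (fderiv ℝ (φ t) x)) t := by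
  obtain ⟨K, C, hK, hC⟩ := exists_lipschitz_bounded hf hc
  obtain ⟨φ, hφ⟩ := exists_isUnitFlow hK hC
  obtain ⟨F, Φ, hF, hFc, hΦ, hA⟩ := exists_variational_field hf hc hφ
  have hfd : ContDiff ℝ ∞ (fderiv ℝ f) := hf.fderiv_right (by simp)
  obtain ⟨K₂, C₂, hK₂, -⟩ := exists_lipschitz_bounded hfd (hc.fderiv ℝ)
  have hD := fun x t ht =>
    (hA.hasFDerivAt hφ (hf.differentiable (by simp)) hK hK₂ x (t := t) ht).fderiv
  refine ⟨φ, hφ, fun t ht => contDiff_infty.2 fun n => hφ.contDiff_nat n hf hc t ht, fun x =>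
    ⟨by rw [hD x 0 (by simp)]; exact hA.zero x, fun t ht => ?_⟩⟩
  rw [hD x t ht]
  refine (hA.hasDerivAt x t ht).congr_of_eventuallyEq ?_
  filter_upwards [Ioo_mem_nhds ht.1 ht.2] with s hs using hD x s hs

end Flow

end

/-! ### Exterior derivative in charts and its naturality -/

section

/-- The exterior derivative of a `1`-form on a vector space, as a bilinear expression. -/
def curl {E : Type*} [NormedAddCommGroup E] [NormedSpace ℝ E] (L : E → E →L[ℝ] ℝ) (y v w : E) : ℝ :=
  fderiv ℝ L y v w - fderiv ℝ L y w v

section Linear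

variable {E F : Type*} [NormedAddCommGroup E] [NormedSpace ℝ E]
  [NormedAddCommGroup F] [NormedSpace ℝ F]

theorem extDeriv_ofSubsingleton {L : E → E →L[ℝ] ℝ} {y : E} (hL : DifferentiableAt ℝ L y)
    (v w : E) : extDeriv (fun y => ContinuousAlternatingMap.ofSubsingleton ℝ E ℝ (0 : Fin 1) (L y))
      y ![v, w] = curl L y v w := by
  let T : (E →L[ℝ] ℝ) ≃ₗᵢ[ℝ] (E [⋀^Fin 1]→L[ℝ] ℝ) :=
    ContinuousAlternatingMap.ofSubsingletonLIE (0 : Fin 1)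
  have h1 : HasFDerivAt
      (fun y => ContinuousAlternatingMap.ofSubsingleton ℝ E ℝ (0 : Fin 1) (L y))
      (T.toContinuousLinearEquiv.toContinuousLinearMap.comp (fderiv ℝ L y)) y :=
    (T.toContinuousLinearEquiv.toContinuousLinearMap.hasFDerivAt).comp y hL.hasFDerivAt
  have h2 : ∀ (u : Fin 1 → E) (a : E), fderiv ℝ
      (fun x => (ContinuousAlternatingMap.ofSubsingleton ℝ E ℝ (0 : Fin 1) (L x)) u) y a =
      fderiv ℝ L y a (u 0) := by
    intro u a
    have := hL.hasFDerivAt.clm_apply (hasFDerivAt_const (u 0) y)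
    have e : fderiv ℝ (fun x => L x (u 0)) y a = fderiv ℝ L y a (u 0) := by
      rw [this.fderiv]; simp
    exact e
  rw [extDeriv_apply h1.differentiableAt, Fin.sum_univ_two, h2, h2]
  simp [curl, sub_eq_add_neg, Fin.removeNth]

/-- The exterior derivative commutes with pullback, and kills exact forms. -/
theorem curl_pullback {L : E → E →L[ℝ] ℝ} {L' : F → F →L[ℝ] ℝ} {τ : E → F} {g : E → ℝ} {y : E}
    (hL' : DifferentiableAt ℝ L' (τ y)) (hτ : ContDiffAt ℝ 2 τ y)
    (hL : DifferentiableAt ℝ L y) (hg : ContDiffAt ℝ 2 g y)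
    (h : ∀ᶠ z in 𝓝 y, (L' (τ z)).comp (fderiv ℝ τ z) - L z = fderiv ℝ g z) (v w : E) :
    curl L' (τ y) (fderiv ℝ τ y v) (fderiv ℝ τ y w) = curl L y v w := by
  have hτ1 : DifferentiableAt ℝ τ y := hτ.differentiableAt (by norm_num)
  have hτ2 : DifferentiableAt ℝ (fderiv ℝ τ) y :=
    (hτ.fderiv_right (m := 1) (by norm_num)).differentiableAt (by norm_num)
  have hg2 : DifferentiableAt ℝ (fderiv ℝ g) y :=
    (hg.fderiv_right (m := 1) (by norm_num)).differentiableAt (by norm_num)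
  have hc : HasFDerivAt (fun z => L' (τ z)) ((fderiv ℝ L' (τ y)).comp (fderiv ℝ τ y)) y :=
    hL'.hasFDerivAt.comp y hτ1.hasFDerivAt
  have key := (hc.clm_comp hτ2.hasFDerivAt).sub hL.hasFDerivAt
  have key2 := key.unique (hg2.hasFDerivAt.congr_of_eventuallyEq h)
  -- Differentiating the pullback identity produces second derivatives of `τ` and `g`; being
  -- symmetric, they cancel on antisymmetrization.
  have s1 : ∀ a b, fderiv ℝ (fderiv ℝ τ) y a b = fderiv ℝ (fderiv ℝ τ) y b a := fun a b =>
    (hτ.isSymmSndFDerivAt (by simp)).eq a b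
  have s2 : ∀ a b, fderiv ℝ (fderiv ℝ g) y a b = fderiv ℝ (fderiv ℝ g) y b a := fun a b =>
    (hg.isSymmSndFDerivAt (by simp)).eq a b
  have e := fun a b => DFunLike.congr_fun (DFunLike.congr_fun key2 a) b
  have e1 := e v w
  have e2 := e w v
  simp at e1 e2
  rw [curl, curl]
  have := s1 v w
  have := s2 v w
  rw [s1 v w, s2 v w] at e1
  linarith

end Linear

section Chart

variable {m : ℕ} {M : Type*} [TopologicalSpace M]
  [ChartedSpace (EuclideanSpace ℝ (Fin m)) M] [IsManifold (𝓡 m) ∞ M]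

/-- The derivative at `x` of the preferred chart around `x₀`. -/
def dchart (x₀ x : M) : TangentSpace (𝓡 m) x →L[ℝ] EuclideanSpace ℝ (Fin m) :=
  mfderiv (𝓡 m) 𝓘(ℝ, EuclideanSpace ℝ (Fin m)) (extChartAt (𝓡 m) x₀) x

/-- The derivative at `y` of the inverse of the preferred chart around `x₀`. -/
def dchartSymm (x₀ : M) (y : EuclideanSpace ℝ (Fin m)) :
    EuclideanSpace ℝ (Fin m) →L[ℝ] TangentSpace (𝓡 m) ((extChartAt (𝓡 m) x₀).symm y) :=
  mfderiv 𝓘(ℝ, EuclideanSpace ℝ (Fin m)) (𝓡 m) (extChartAt (𝓡 m) x₀).symm y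

theorem mfderiv_symm_comp_chart {x₀ x : M} (hx : x ∈ (extChartAt (𝓡 m) x₀).source)
    (v : TangentSpace (𝓡 m) x) :
    dchartSymm x₀ (extChartAt (𝓡 m) x₀ x)
      (dchart x₀ x v) = v := by
  have h := mfderivWithin_extChartAt_symm_comp_mfderiv_extChartAt' (I := 𝓡 m) hx
  rw [ModelWithCorners.range_eq_univ, mfderivWithin_univ] at h
  exact DFunLike.congr_fun h v

theorem contMDiffAt_chart {x₀ x : M} (hx : x ∈ (extChartAt (𝓡 m) x₀).source) :
    ContMDiffAt (𝓡 m) 𝓘(ℝ, EuclideanSpace ℝ (Fin m)) ∞ (extChartAt (𝓡 m) x₀) x :=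
  contMDiffAt_extChartAt' (by simpa using hx)

theorem contMDiffAt_chart_symm {x₀ : M} {y : EuclideanSpace ℝ (Fin m)}
    (hy : y ∈ (extChartAt (𝓡 m) x₀).target) :
    ContMDiffAt 𝓘(ℝ, EuclideanSpace ℝ (Fin m)) (𝓡 m) ∞ (extChartAt (𝓡 m) x₀).symm y :=
  (contMDiffOn_extChartAt_symm x₀).contMDiffAt ((isOpen_extChartAt_target x₀).mem_nhds hy)

/-- Links the trivialization of the cotangent bundle to chart expressions, so that smoothness of a
section can be read off from `inChart`, and conversely. -/
theorem inCoordinates_covector {x₀ x : M} (hx : x ∈ (chartAt (EuclideanSpace ℝ (Fin m)) x₀).source)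
    (α : TangentSpace (𝓡 m) x →L[ℝ] ℝ) :
    ContinuousLinearMap.inCoordinates (σ := RingHom.id ℝ) (EuclideanSpace ℝ (Fin m)) (TangentSpace (𝓡 m)) ℝ
      (Bundle.Trivial M ℝ) x₀ x x₀ x α =
    α.comp (dchartSymm x₀ (extChartAt (𝓡 m) x₀ x)) := by
  rw [ContinuousLinearMap.inCoordinates, TangentBundle.symmL_trivializationAt hx]
  simp
  rfl

theorem OneForm.inChart_apply (lam : OneForm m M) (x₀ : M) (y w : EuclideanSpace ℝ (Fin m)) :
    lam.inChart x₀ y w = lam.eval ((extChartAt (𝓡 m) x₀).symm y)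
      (dchartSymm x₀ y w) := rfl

theorem OneForm.inChart_mfderiv (lam : OneForm m M) {x₀ x : M}
    (hx : x ∈ (extChartAt (𝓡 m) x₀).source) (v : TangentSpace (𝓡 m) x) :
    lam.inChart x₀ (extChartAt (𝓡 m) x₀ x)
      (dchart x₀ x v) =
      lam.eval x v := by
  rw [OneForm.inChart_apply, mfderiv_symm_comp_chart hx]
  have : ∀ (z : M) (hz : z = x) (u : EuclideanSpace ℝ (Fin m)), lam.eval z u = lam.eval x u := by
    rintro z rfl u; rfl
  exact this _ ((extChartAt (𝓡 m) x₀).left_inv hx) v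

theorem OneForm.contDiffAt_inChart (lam : OneForm m M) (x₀ : M) {y : EuclideanSpace ℝ (Fin m)}
    (hy : y ∈ (extChartAt (𝓡 m) x₀).target) : ContDiffAt ℝ ∞ (lam.inChart x₀) y := by
  set c := extChartAt (𝓡 m) x₀ with hc
  have hs : c.symm y ∈ c.source := c.map_target hy
  have hs' : c.symm y ∈ (chartAt (EuclideanSpace ℝ (Fin m)) x₀).source := by
    rwa [hc, extChartAt_source] at hs
  have h := (Bundle.Trivialization.contMDiffAt_section_iff (IB := 𝓡 m) (n := ∞)
    (trivializationAt (EuclideanSpace ℝ (Fin m) →L[ℝ] ℝ)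
      (fun x : M => TangentSpace (𝓡 m) x →L[ℝ] Bundle.Trivial M ℝ x) x₀)
    (x₀ := c.symm y) (by simpa using hs')).1 (lam.contMDiff (c.symm y))
  rw [← contMDiffAt_iff_contDiffAt]
  refine (h.comp y (contMDiffAt_chart_symm hy)).congr_of_eventuallyEq ?_
  filter_upwards [(isOpen_extChartAt_target x₀).mem_nhds hy] with z hz
  have hz' : c.symm z ∈ (chartAt (EuclideanSpace ℝ (Fin m)) x₀).source := by
    have := c.map_target hz
    rwa [hc, extChartAt_source] at this
  have e := inCoordinates_covector hz' (lam.eval (c.symm z))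
  rw [← hc, c.right_inv hz] at e
  exact e.symm

/-- Naturality of the exterior derivative, in arbitrary charts. -/
theorem curl_inChart_pullback {N : Type*} [TopologicalSpace N]
    [ChartedSpace (EuclideanSpace ℝ (Fin m)) N] [IsManifold (𝓡 m) ∞ N]
    {lam : OneForm m M} {mu : OneForm m N} {f : M → N} {g : M → ℝ} {x x₀ : M} {x₁ : N}
    (hx₀ : x ∈ (extChartAt (𝓡 m) x₀).source) (hx₁ : f x ∈ (extChartAt (𝓡 m) x₁).source)
    (hf : ∀ᶠ z in 𝓝 x, ContMDiffAt (𝓡 m) (𝓡 m) ∞ f z)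
    (hg : ∀ᶠ z in 𝓝 x, ContMDiffAt (𝓡 m) 𝓘(ℝ, ℝ) ∞ g z)
    (h : ∀ᶠ z in 𝓝 x, ∀ v : TangentSpace (𝓡 m) z,
      mu.eval (f z) (mfderiv (𝓡 m) (𝓡 m) f z v) - lam.eval z v = mfderiv (𝓡 m) 𝓘(ℝ, ℝ) g z v)
    (v w : TangentSpace (𝓡 m) x) :
    curl (mu.inChart x₁) (extChartAt (𝓡 m) x₁ (f x))
      (dchart x₁ (f x)
        (mfderiv (𝓡 m) (𝓡 m) f x v))
      (dchart x₁ (f x)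
        (mfderiv (𝓡 m) (𝓡 m) f x w)) =
    curl (lam.inChart x₀) (extChartAt (𝓡 m) x₀ x)
      (dchart x₀ x v)
      (dchart x₀ x w) := by
  set c := extChartAt (𝓡 m) x₀ with hc
  set c' := extChartAt (𝓡 m) x₁ with hc'
  have hy : c x ∈ c.target := c.map_source hx₀
  have hyx : c.symm (c x) = x := c.left_inv hx₀
  set τ : EuclideanSpace ℝ (Fin m) → EuclideanSpace ℝ (Fin m) := fun z => c' (f (c.symm z)) with hτ
  have hτy : τ (c x) = c' (f x) := by simp only [hτ, hyx]
  have hcs : ∀ z ∈ c.target, ContMDiffAt 𝓘(ℝ, EuclideanSpace ℝ (Fin m)) (𝓡 m) ∞ c.symm z :=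
    fun z hz => contMDiffAt_chart_symm hz
  have hcont : Tendsto c.symm (𝓝 (c x)) (𝓝 x) := by
    have := (hcs _ hy).continuousAt
    rwa [ContinuousAt, hyx] at this
  have hfs : ∀ᶠ z in 𝓝 x, f z ∈ c'.source :=
    hf.self_of_nhds.continuousAt.eventually ((isOpen_extChartAt_source x₁).mem_nhds hx₁)
  have hcomp : ∀ z ∈ c.target, ContMDiffAt (𝓡 m) (𝓡 m) ∞ f (c.symm z) → f (c.symm z) ∈ c'.source →
      ContMDiffAt 𝓘(ℝ, EuclideanSpace ℝ (Fin m)) 𝓘(ℝ, EuclideanSpace ℝ (Fin m)) ∞ τ z ∧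
      ∀ a, fderiv ℝ τ z a = dchart x₁ (f (c.symm z))
        (mfderiv (𝓡 m) (𝓡 m) f (c.symm z)
          (dchartSymm x₀ z a)) := by
    intro z hz h1 h2
    have a1 := (hcs z hz)
    have a2 : ContMDiffAt 𝓘(ℝ, EuclideanSpace ℝ (Fin m)) (𝓡 m) ∞ (fun z => f (c.symm z)) z :=
      h1.comp z a1
    have a3 := contMDiffAt_chart h2
    refine ⟨a3.comp z a2, fun a => ?_⟩
    rw [← mfderiv_eq_fderiv]
    have b1 := mfderiv_comp_apply z (a3.mdifferentiableAt (by simp))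
      (a2.mdifferentiableAt (by simp)) a
    have b2 := mfderiv_comp_apply z (h1.mdifferentiableAt (by simp))
      (a1.mdifferentiableAt (by simp)) a
    exact b1.trans (congrArg _ b2)
  have hτ1 := hcomp (c x) hy (by rw [hyx]; exact hf.self_of_nhds) (by rw [hyx]; exact hx₁)
  have hga : ContDiffAt ℝ ∞ (fun z => g (c.symm z)) (c x) := by
    rw [← contMDiffAt_iff_contDiffAt]
    exact (ContMDiffAt.comp_of_eq hg.self_of_nhds (hcs _ hy) hyx)
  have key := curl_pullback (L := lam.inChart x₀) (L' := mu.inChart x₁) (τ := τ)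
    (g := fun z => g (c.symm z)) (y := c x)
    ((mu.contDiffAt_inChart x₁ (by rw [hτy]; exact c'.map_source hx₁)).differentiableAt (by simp))
    ((contMDiffAt_iff_contDiffAt.1 hτ1.1).of_le ENat.LEInfty.out)
    ((lam.contDiffAt_inChart x₀ hy).differentiableAt (by simp))
    (hga.of_le ENat.LEInfty.out) ?_
    (dchart x₀ x v)
    (dchart x₀ x w)
  · have e : ∀ u : TangentSpace (𝓡 m) x,
        fderiv ℝ τ (c x) (dchart x₀ x u) =
        dchart x₁ (f x) (mfderiv (𝓡 m) (𝓡 m) f x u) := by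
      intro u
      refine (hτ1.2 _).trans ?_
      rw [mfderiv_symm_comp_chart hx₀]
      have : ∀ (z : M) (hz : z = x), dchart x₁ (f z)
          (mfderiv (𝓡 m) (𝓡 m) f z u) = dchart x₁ (f x)
            (mfderiv (𝓡 m) (𝓡 m) f x u) := by
        rintro z rfl; rfl
      exact this _ hyx
    rw [e, e, hτy] at key
    exact key
  · filter_upwards [hcont.eventually hf, hcont.eventually hg, hcont.eventually h,
      hcont.eventually hfs, (isOpen_extChartAt_target x₀).mem_nhds hy] with z z1 z2 z3 z4 z5
    ext a
    have e1 := (hcomp z z5 z1 z4).2 a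
    have e2 : fderiv ℝ (fun z => g (c.symm z)) z a = mfderiv (𝓡 m) 𝓘(ℝ, ℝ) g (c.symm z)
        (dchartSymm x₀ z a) := by
      rw [← mfderiv_eq_fderiv]
      exact mfderiv_comp_apply z (z2.mdifferentiableAt (by simp))
        ((hcs z z5).mdifferentiableAt (by simp)) a
    have e3 := mu.inChart_mfderiv z4 (mfderiv (𝓡 m) (𝓡 m) f (c.symm z)
          (dchartSymm x₀ z a))
    rw [e2, ← z3]
    change mu.inChart x₁ (τ z) (fderiv ℝ τ z a) - lam.inChart x₀ z a = _
    rw [e1]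
    exact congrArg₂ (· - ·) e3 rfl

theorem OneForm.d_eq_curl_self (lam : OneForm m M) (x : M) (v w : TangentSpace (𝓡 m) x) :
    lam.d x ![v, w] = curl (lam.inChart x) (extChartAt (𝓡 m) x x)
      (dchart x x v)
      (dchart x x w) := by
  rw [← extDeriv_ofSubsingleton ((lam.contDiffAt_inChart x
    (mem_extChartAt_target x)).differentiableAt (by simp))]
  refine congrArg (extDeriv (fun y => ContinuousAlternatingMap.ofSubsingleton ℝ
    (EuclideanSpace ℝ (Fin m)) ℝ (0 : Fin 1) (lam.inChart x y)) (extChartAt (𝓡 m) x x)) ?_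
  funext i
  fin_cases i <;> rfl

/-- Naturality under the identity map, read in two different charts, shows that `d` does not depend
on the chart. -/
theorem OneForm.d_eq_curl (lam : OneForm m M) {x x₀ : M}
    (hx : x ∈ (extChartAt (𝓡 m) x₀).source) (v w : TangentSpace (𝓡 m) x) :
    lam.d x ![v, w] = curl (lam.inChart x₀) (extChartAt (𝓡 m) x₀ x)
      (dchart x₀ x v)
      (dchart x₀ x w) := by
  rw [OneForm.d_eq_curl_self]
  have := curl_inChart_pullback (lam := lam) (mu := lam) (f := id) (g := fun _ => 0) (x := x)
    hx (x₁ := x) (mem_extChartAt_source x) (Eventually.of_forall fun z => contMDiffAt_id)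
    (Eventually.of_forall fun z => contMDiffAt_const) (Eventually.of_forall fun z u => by
      rw [mfderiv_id, mfderiv_const]; simp; rfl) v w
  rw [mfderiv_id] at this
  exact this

theorem d_pullback {N : Type*} [TopologicalSpace N]
    [ChartedSpace (EuclideanSpace ℝ (Fin m)) N] [IsManifold (𝓡 m) ∞ N]
    {lam : OneForm m M} {mu : OneForm m N} {f : M → N} {g : M → ℝ} {x : M}
    (hf : ∀ᶠ z in 𝓝 x, ContMDiffAt (𝓡 m) (𝓡 m) ∞ f z)
    (hg : ∀ᶠ z in 𝓝 x, ContMDiffAt (𝓡 m) 𝓘(ℝ, ℝ) ∞ g z)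
    (h : ∀ᶠ z in 𝓝 x, ∀ v : TangentSpace (𝓡 m) z,
      mu.eval (f z) (mfderiv (𝓡 m) (𝓡 m) f z v) - lam.eval z v = mfderiv (𝓡 m) 𝓘(ℝ, ℝ) g z v)
    (v w : TangentSpace (𝓡 m) x) :
    mu.d (f x) ![mfderiv (𝓡 m) (𝓡 m) f x v, mfderiv (𝓡 m) (𝓡 m) f x w] = lam.d x ![v, w] := by
  rw [OneForm.d_eq_curl_self, OneForm.d_eq_curl_self]
  exact curl_inChart_pullback (mem_extChartAt_source x) (mem_extChartAt_source _) hf hg h v w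

end Chart

end

/-! ### Smoothness of the Liouville field; inverse function theorem -/

section

variable {m : ℕ} {M : Type*} [TopologicalSpace M]
  [ChartedSpace (EuclideanSpace ℝ (Fin m)) M] [IsManifold (𝓡 m) ∞ M]

theorem dchart_dchartSymm {x₀ : M} {y : EuclideanSpace ℝ (Fin m)}
    (hy : y ∈ (extChartAt (𝓡 m) x₀).target) (w : EuclideanSpace ℝ (Fin m)) :
    dchart x₀ ((extChartAt (𝓡 m) x₀).symm y) (dchartSymm x₀ y w) = w := by
  have h := mfderiv_extChartAt_comp_mfderivWithin_extChartAt_symm (I := 𝓡 m) hy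
  rw [ModelWithCorners.range_eq_univ, mfderivWithin_univ] at h
  exact DFunLike.congr_fun h w

theorem dchart_injective {x₀ x : M} (hx : x ∈ (extChartAt (𝓡 m) x₀).source) :
    Function.Injective (dchart (m := m) x₀ x) := by
  rw [injective_iff_map_eq_zero]
  intro v hv
  have h := mfderiv_symm_comp_chart hx v
  rw [hv, map_zero] at h
  exact h.symm

theorem dchart_surjective {x₀ x : M} (hx : x ∈ (extChartAt (𝓡 m) x₀).source) :
    Function.Surjective (dchart (m := m) x₀ x) := by
  have h : ∀ u, ∃ u', dchart x₀ ((extChartAt (𝓡 m) x₀).symm (extChartAt (𝓡 m) x₀ x)) u' = u :=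
    fun u => ⟨_, dchart_dchartSymm ((extChartAt (𝓡 m) x₀).map_source hx) u⟩
  rwa [(extChartAt (𝓡 m) x₀).left_inv hx] at h

/-- The Liouville field in the chart around `x₀`. -/
def fieldInChart (lam : OneForm m M) (x₀ : M) (y : EuclideanSpace ℝ (Fin m)) :
    EuclideanSpace ℝ (Fin m) :=
  dchart x₀ ((extChartAt (𝓡 m) x₀).symm y) (liouvilleField lam ((extChartAt (𝓡 m) x₀).symm y))

theorem OneForm.d_symm_eq_curl (lam : OneForm m M) {x₀ : M} {y : EuclideanSpace ℝ (Fin m)}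
    (hy : y ∈ (extChartAt (𝓡 m) x₀).target)
    (v w : TangentSpace (𝓡 m) ((extChartAt (𝓡 m) x₀).symm y)) :
    lam.d ((extChartAt (𝓡 m) x₀).symm y) ![v, w] = curl (lam.inChart x₀) y
      (dchart x₀ ((extChartAt (𝓡 m) x₀).symm y) v)
      (dchart x₀ ((extChartAt (𝓡 m) x₀).symm y) w) := by
  rw [lam.d_eq_curl ((extChartAt (𝓡 m) x₀).map_target hy), (extChartAt (𝓡 m) x₀).right_inv hy]

theorem curl_fieldInChart {lam : OneForm m M} (h : IsExactSymplectic lam) {x₀ : M}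
    {y : EuclideanSpace ℝ (Fin m)} (hy : y ∈ (extChartAt (𝓡 m) x₀).target)
    (w : EuclideanSpace ℝ (Fin m)) :
    curl (lam.inChart x₀) y (fieldInChart lam x₀ y) w = lam.inChart x₀ y w := by
  have := liouvilleField_spec h ((extChartAt (𝓡 m) x₀).symm y) (dchartSymm x₀ y w)
  rw [lam.d_symm_eq_curl hy, dchart_dchartSymm hy] at this
  exact this

theorem eq_zero_of_curl_eq_zero {lam : OneForm m M} (h : IsExactSymplectic lam) {x₀ : M}
    {y : EuclideanSpace ℝ (Fin m)} (hy : y ∈ (extChartAt (𝓡 m) x₀).target)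
    {u : EuclideanSpace ℝ (Fin m)} (hu : ∀ w, curl (lam.inChart x₀) y u w = 0) : u = 0 := by
  have := h ((extChartAt (𝓡 m) x₀).symm y) (dchartSymm x₀ y u) fun w => by
    rw [lam.d_symm_eq_curl hy, dchart_dchartSymm hy, hu]
  rw [← dchart_dchartSymm hy u, this, map_zero]

/-- An injective continuous linear map between finite-dimensional spaces of the same dimension, as
a continuous linear equivalence. -/
theorem exists_equiv_of_injective {E F : Type*} [NormedAddCommGroup E] [NormedSpace ℝ E]
    [FiniteDimensional ℝ E] [NormedAddCommGroup F] [NormedSpace ℝ F] [FiniteDimensional ℝ F]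
    (hd : Module.finrank ℝ E = Module.finrank ℝ F) (T : E →L[ℝ] F) (hT : Function.Injective T) :
    ∃ e : E ≃L[ℝ] F, (e : E →L[ℝ] F) = T :=
  ⟨(LinearEquiv.ofInjectiveOfFinrankEq T.toLinearMap hT hd).toContinuousLinearEquiv, by
    ext v; rfl⟩

/-- In the chart the field is `B⁻¹ L`, with `L` the `1`-form and `B` its nondegenerate exterior
derivative; inversion of linear maps is smooth. -/
theorem contDiffAt_fieldInChart {lam : OneForm m M} (h : IsExactSymplectic lam) {x₀ : M}
    {y : EuclideanSpace ℝ (Fin m)} (hy : y ∈ (extChartAt (𝓡 m) x₀).target) :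
    ContDiffAt ℝ ∞ (fieldInChart lam x₀) y := by
  set L := lam.inChart x₀ with hL
  let B : EuclideanSpace ℝ (Fin m) → EuclideanSpace ℝ (Fin m) →L[ℝ] EuclideanSpace ℝ (Fin m) →L[ℝ] ℝ := fun z => fderiv ℝ L z - (fderiv ℝ L z).flip
  have hB : ∀ z v w, B z v w = curl L z v w := fun z v w => by simp [B, curl]
  have hLs : ContDiffAt ℝ ∞ L y := lam.contDiffAt_inChart x₀ hy
  have hfd : ContDiffAt ℝ ∞ (fderiv ℝ L) y := hLs.fderiv_right (by simp)
  have hflip : ContDiff ℝ ∞ (fun T : EuclideanSpace ℝ (Fin m) →L[ℝ]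
      EuclideanSpace ℝ (Fin m) →L[ℝ] ℝ => T.flip) :=
    contDiff_clm_apply_iff.2 fun v => contDiff_clm_apply_iff.2 fun w =>
      (contDiff_id.clm_apply contDiff_const).clm_apply contDiff_const
  have hBs : ContDiffAt ℝ ∞ B y := hfd.sub (hflip.contDiffAt.comp y hfd)
  have hinj : ∀ z ∈ (extChartAt (𝓡 m) x₀).target, ∃ e : EuclideanSpace ℝ (Fin m) ≃L[ℝ] (EuclideanSpace ℝ (Fin m) →L[ℝ] ℝ),
      (e : EuclideanSpace ℝ (Fin m) →L[ℝ] EuclideanSpace ℝ (Fin m) →L[ℝ] ℝ) = B z := by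
    intro z hz
    refine exists_equiv_of_injective ?_ (B z) ?_
    · rw [← (LinearMap.toContinuousLinearMap (𝕜 := ℝ) (E := EuclideanSpace ℝ (Fin m)) (F' := ℝ)).finrank_eq]
      exact Subspace.dual_finrank_eq.symm
    · rw [injective_iff_map_eq_zero]
      intro u hu
      exact eq_zero_of_curl_eq_zero h hz fun w => by rw [← hL, ← hB, hu]; rfl
  obtain ⟨e, he⟩ := hinj y hy
  have hinv : ContDiffAt ℝ ∞ (fun z => (B z).inverse) y := by
    have := contDiffAt_map_inverse (𝕜 := ℝ) (n := ∞) e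
    rw [he] at this
    exact this.comp y hBs
  refine (hinv.clm_apply hLs).congr_of_eventuallyEq ?_
  filter_upwards [(isOpen_extChartAt_target x₀).mem_nhds hy] with z hz
  obtain ⟨e', he'⟩ := hinj z hz
  have : B z (fieldInChart lam x₀ z) = L z := by
    ext w
    rw [hB, curl_fieldInChart h hz]
  rw [← this, ← he']
  simp

theorem contMDiff_liouvilleField {lam : OneForm m M} (h : IsExactSymplectic lam) :
    ContMDiff (𝓡 m) (𝓡 m).tangent ∞
      (fun x => (⟨x, liouvilleField lam x⟩ : TangentBundle (𝓡 m) M)) := by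
  intro x₀
  refine (Bundle.contMDiffAt_section x₀).2 ?_
  have h1 : ContMDiffAt (𝓡 m) 𝓘(ℝ, EuclideanSpace ℝ (Fin m)) ∞
      (fun x => fieldInChart lam x₀ (extChartAt (𝓡 m) x₀ x)) x₀ :=
    (contMDiffAt_iff_contDiffAt.2 (contDiffAt_fieldInChart h (mem_extChartAt_target x₀))).comp x₀
      (contMDiffAt_chart (mem_extChartAt_source x₀))
  refine h1.congr_of_eventuallyEq ?_
  filter_upwards [(isOpen_extChartAt_source (I := 𝓡 m) x₀).mem_nhds (mem_extChartAt_source x₀)]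
    with x hx
  have hx' : x ∈ (chartAt (EuclideanSpace ℝ (Fin m)) x₀).source := by
    rwa [extChartAt_source] at hx
  have e := TangentBundle.continuousLinearMapAt_trivializationAt (I := 𝓡 m) hx'
  have e2 : ∀ z : M, z = x → dchart x₀ z (liouvilleField lam z) =
      dchart x₀ x (liouvilleField lam x) := by rintro z rfl; rfl
  rw [fieldInChart, e2 _ ((extChartAt (𝓡 m) x₀).left_inv hx)]
  refine Eq.trans ?_ (DFunLike.congr_fun e (liouvilleField lam x))
  rw [Bundle.Trivialization.continuousLinearMapAt_apply,
    Bundle.Trivialization.coe_linearMapAt_of_mem _ (by simpa using hx')]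

/-- The inverse function theorem for maps between manifolds. -/
theorem exists_localInverse {N : Type*} [TopologicalSpace N]
    [ChartedSpace (EuclideanSpace ℝ (Fin m)) N] [IsManifold (𝓡 m) ∞ N] {f : M → N} {x : M}
    (hf : ContMDiffAt (𝓡 m) (𝓡 m) ∞ f x)
    (hinj : Function.Injective (mfderiv (𝓡 m) (𝓡 m) f x)) :
    ∃ j : N → M, ContMDiffAt (𝓡 m) (𝓡 m) ∞ j (f x) ∧ j (f x) = x ∧
      (∀ᶠ w in 𝓝 (f x), f (j w) = w) ∧ ∀ᶠ z in 𝓝 x, j (f z) = z := by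
  set c := extChartAt (𝓡 m) x with hc
  set c' := extChartAt (𝓡 m) (f x) with hc'
  have hx : x ∈ c.source := mem_extChartAt_source x
  have hfx : f x ∈ c'.source := mem_extChartAt_source (f x)
  have hy : c x ∈ c.target := c.map_source hx
  have hyx : c.symm (c x) = x := c.left_inv hx
  set τ : EuclideanSpace ℝ (Fin m) → EuclideanSpace ℝ (Fin m) := fun z => c' (f (c.symm z)) with hτ
  have hτy : τ (c x) = c' (f x) := by simp only [hτ, hyx]
  have a1 := contMDiffAt_chart_symm hy
  have a2 : ContMDiffAt 𝓘(ℝ, EuclideanSpace ℝ (Fin m)) (𝓡 m) ∞ (fun z => f (c.symm z)) (c x) :=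
    ContMDiffAt.comp_of_eq hf a1 hyx
  have a3 : ContMDiffAt 𝓘(ℝ, EuclideanSpace ℝ (Fin m)) 𝓘(ℝ, EuclideanSpace ℝ (Fin m)) ∞ τ (c x) :=
    ContMDiffAt.comp_of_eq (contMDiffAt_chart hfx) a2 (by simp only [hyx])
  have hτs : ContDiffAt ℝ ∞ τ (c x) := contMDiffAt_iff_contDiffAt.1 a3
  have hd : ∀ u : TangentSpace (𝓡 m) x, fderiv ℝ τ (c x) (dchart x x u) =
      dchart (f x) (f x) (mfderiv (𝓡 m) (𝓡 m) f x u) := by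
    intro u
    have b1 : mfderiv (𝓡 m) 𝓘(ℝ, EuclideanSpace ℝ (Fin m)) (fun z => τ (c z)) x u =
        fderiv ℝ τ (c x) (dchart x x u) := by
      rw [← mfderiv_eq_fderiv]
      exact mfderiv_comp_apply x (a3.mdifferentiableAt (by simp))
        ((contMDiffAt_chart hx).mdifferentiableAt (by simp)) u
    have b2 : mfderiv (𝓡 m) 𝓘(ℝ, EuclideanSpace ℝ (Fin m)) (fun z => c' (f z)) x u =
        dchart (f x) (f x) (mfderiv (𝓡 m) (𝓡 m) f x u) :=
      mfderiv_comp_apply x ((contMDiffAt_chart hfx).mdifferentiableAt (by simp))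
        (hf.mdifferentiableAt (by simp)) u
    have b3 : (fun z => τ (c z)) =ᶠ[𝓝 x] fun z => c' (f z) := by
      filter_upwards [(isOpen_extChartAt_source (I := 𝓡 m) x).mem_nhds hx] with z hz
      simp only [hτ, hc, (extChartAt (𝓡 m) x).left_inv hz]
    rw [← b1, ← b2, b3.mfderiv_eq]; rfl
  have hinjτ : Function.Injective (fderiv ℝ τ (c x)) := by
    rw [injective_iff_map_eq_zero]
    intro u hu
    obtain ⟨u', rfl⟩ := dchart_surjective hx u
    have h1 := hd u'
    rw [hu] at h1
    have h3 : u' = 0 := hinj (dchart_injective hfx (by rw [← h1, map_zero, map_zero]))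
    rw [h3, map_zero]
  obtain ⟨e, he⟩ := exists_equiv_of_injective rfl _ hinjτ
  have hτd : HasFDerivAt τ (e : EuclideanSpace ℝ (Fin m) →L[ℝ] EuclideanSpace ℝ (Fin m)) (c x) := by
    rw [he]
    exact (hτs.differentiableAt (by simp)).hasFDerivAt
  set σ := hτs.localInverse hτd (by simp) with hσ
  have hσs : ContDiffAt ℝ ∞ σ (c' (f x)) := by
    rw [← hτy]; exact hτs.to_localInverse hτd (by simp)
  have hσ0 : σ (c' (f x)) = c x := by
    rw [← hτy]; exact hτs.localInverse_apply_image hτd (by simp)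
  have hst := hτs.hasStrictFDerivAt' hτd (by simp)
  have hl : ∀ᶠ z in 𝓝 (c x), σ (τ z) = z := hst.eventually_left_inverse
  have hr : ∀ᶠ z in 𝓝 (c' (f x)), τ (σ z) = z := by
    rw [← hτy]; exact hst.eventually_right_inverse
  have hc's := (contMDiffAt_chart hfx).continuousAt
  have hcs := (contMDiffAt_chart hx).continuousAt
  have hσc : ContMDiffAt (𝓡 m) 𝓘(ℝ, EuclideanSpace ℝ (Fin m)) ∞ (fun w => σ (c' w)) (f x) :=
    (contMDiffAt_iff_contDiffAt.2 hσs).comp (f x) (contMDiffAt_chart hfx)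
  have hj : ContMDiffAt (𝓡 m) (𝓡 m) ∞ (fun w => c.symm (σ (c' w))) (f x) :=
    ContMDiffAt.comp_of_eq a1 hσc hσ0
  have hj0 : c.symm (σ (c' (f x))) = x := by rw [hσ0, hyx]
  refine ⟨fun w => c.symm (σ (c' w)), hj, hj0, ?_, ?_⟩
  · have h1 : ∀ᶠ w in 𝓝 (f x), f (c.symm (σ (c' w))) ∈ c'.source := by
      have : ContinuousAt (fun w => f (c.symm (σ (c' w)))) (f x) :=
        ContinuousAt.comp_of_eq hf.continuousAt hj.continuousAt hj0
      exact this.eventually ((isOpen_extChartAt_source (f x)).mem_nhds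
        (by simpa only [hj0] using hfx))
    filter_upwards [hc's.eventually hr, h1,
      (isOpen_extChartAt_source (I := 𝓡 m) (f x)).mem_nhds hfx] with w w1 w2 w3
    exact c'.injOn w2 w3 w1
  · filter_upwards [hcs.eventually hl, (isOpen_extChartAt_source (I := 𝓡 m) x).mem_nhds hx]
      with z z1 z2
    have e1 : τ (c z) = c' (f z) := by simp only [hτ, hc, (extChartAt (𝓡 m) x).left_inv z2]
    rw [← e1, z1]
    exact c.left_inv z2

end

/-! ### Local Liouville flow and its effect on the form -/

section

variable {m : ℕ} {M : Type*} [TopologicalSpace M]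
  [ChartedSpace (EuclideanSpace ℝ (Fin m)) M] [IsManifold (𝓡 m) ∞ M]

theorem dchartSymm_dchart {x₀ : M} {y : EuclideanSpace ℝ (Fin m)}
    (hy : y ∈ (extChartAt (𝓡 m) x₀).target)
    (v : TangentSpace (𝓡 m) ((extChartAt (𝓡 m) x₀).symm y)) :
    dchartSymm x₀ y (dchart x₀ ((extChartAt (𝓡 m) x₀).symm y) v) = v := by
  have h := mfderivWithin_extChartAt_symm_comp_mfderiv_extChartAt (I := 𝓡 m) hy
  rw [ModelWithCorners.range_eq_univ, mfderivWithin_univ] at h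
  exact DFunLike.congr_fun h v

/-- The chart expression of `ℒ_X lam = lam` for the Liouville field `X`. -/
theorem lieDeriv_inChart {lam : OneForm m M} (h : IsExactSymplectic lam) {x₀ : M}
    {y : EuclideanSpace ℝ (Fin m)} (hy : y ∈ (extChartAt (𝓡 m) x₀).target)
    (z : EuclideanSpace ℝ (Fin m)) :
    fderiv ℝ (lam.inChart x₀) y (fieldInChart lam x₀ y) z +
      lam.inChart x₀ y (fderiv ℝ (fieldInChart lam x₀) y z) = lam.inChart x₀ y z := by
  have h1 := curl_fieldInChart h hy z
  -- The form vanishes on its own Liouville field, by antisymmetry of `d lam`. Thus in Cartan's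
  -- formula only the contraction of `d lam` survives, and it equals `lam`.
  have h0 : (fun y => lam.inChart x₀ y (fieldInChart lam x₀ y)) =ᶠ[𝓝 y] fun _ => 0 := by
    filter_upwards [(isOpen_extChartAt_target x₀).mem_nhds hy] with a ha
    rw [← curl_fieldInChart h ha, curl, sub_self]
  have h2 := (((lam.contDiffAt_inChart x₀ hy).differentiableAt (by simp)).hasFDerivAt.clm_apply
    ((contDiffAt_fieldInChart h hy).differentiableAt (by simp)).hasFDerivAt)
  have h3 := h2.unique ((hasFDerivAt_const (0 : ℝ) y).congr_of_eventuallyEq h0)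
  have h4 := DFunLike.congr_fun h3 z
  simp at h4
  rw [curl] at h1
  linarith

theorem norm_flow_sub_le {E : Type*} [NormedAddCommGroup E] [NormedSpace ℝ E] {f : E → E}
    {φ : ℝ → E → E} (hφ : IsUnitFlow f φ) {C : NNReal} (hC : ∀ x, ‖f x‖ ≤ C) (x : E) {t : ℝ}
    (ht : t ∈ Ioo (-1 : ℝ) 1) : ‖φ t x - x‖ ≤ C * |t| := by
  have := (convex_Ioo (-1 : ℝ) 1).norm_image_sub_le_of_norm_hasDerivWithin_le
    (f := fun s => φ s x) (fun s hs => (hφ.hasDerivAt x s hs).hasDerivWithinAt)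
    (fun s _ => hC _) (show (0 : ℝ) ∈ Ioo (-1 : ℝ) 1 by simp) ht
  simpa [hφ.zero] using this

theorem eq_exp_mul_of_hasDerivAt {u : ℝ → ℝ} {ε : ℝ}
    (hu : ∀ t ∈ Ioo (-ε) ε, HasDerivAt u (u t) t) {t : ℝ} (ht : t ∈ Ioo (-ε) ε) :
    u t = Real.exp t * u 0 := by
  have h0 : (0 : ℝ) ∈ Ioo (-ε) ε := by constructor <;> linarith [ht.1, ht.2]
  have := (convex_Ioo (-ε) ε).norm_image_sub_le_of_norm_hasDerivWithin_le (C := 0)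
    (f := fun s => Real.exp (-s) * u s) (f' := fun _ => 0)
    (fun s hs => by
      have := ((hasDerivAt_neg s).exp.mul (hu s hs))
      exact (this.congr_deriv (by ring)).hasDerivWithinAt) (fun s _ => by simp) h0 ht
  simp only [neg_zero, Real.exp_zero, one_mul, zero_mul, norm_le_zero_iff, sub_eq_zero] at this
  rw [← this, ← mul_assoc, ← Real.exp_add]
  simp

/-- A local flow of the Liouville field: it is smooth, and the time-`t` map scales the `1`-form by
`exp t`. -/
theorem exists_local_flow {lam : OneForm m M} (h : IsExactSymplectic lam) (x₀ : M) :
    ∃ ε > 0, ∃ N : Set M, IsOpen N ∧ x₀ ∈ N ∧ ∃ φ : ℝ → M → M, ∀ x ∈ N, φ 0 x = x ∧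
      IsMIntegralCurveOn (I := 𝓡 m) (fun t => φ t x) (liouvilleField lam) (Ioo (-ε) ε) ∧
      ∀ t ∈ Ioo (-ε) ε, ContMDiffAt (𝓡 m) (𝓡 m) ∞ (φ t) x ∧ ∀ v : TangentSpace (𝓡 m) x,
        lam.eval (φ t x) (mfderiv (𝓡 m) (𝓡 m) (φ t) x v) = Real.exp t * lam.eval x v := by
  set c := extChartAt (𝓡 m) x₀ with hc
  set X := fieldInChart lam x₀ with hX
  have hopen : IsOpen c.target := isOpen_extChartAt_target x₀
  obtain ⟨r, hr, hball⟩ := Metric.isOpen_iff.1 hopen (c x₀) (mem_extChartAt_target x₀)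
  -- The cutoff field is globally defined and equals the Liouville field on the ball of radius `r /
  -- 3`. Points within `r / 6` of the centre stay in that ball for times below `ε`.
  let χ : ContDiffBump (c x₀) := ⟨r / 3, r / 2, by positivity, by linarith⟩
  have hsupp : tsupport χ ⊆ c.target := by
    rw [χ.tsupport_eq]
    exact (Metric.closedBall_subset_ball (by change r / 2 < r; linarith)).trans hball
  let f : EuclideanSpace ℝ (Fin m) → EuclideanSpace ℝ (Fin m) := fun y => χ y • X y
  have hf : ContDiff ℝ ∞ f := by
    rw [contDiff_iff_contDiffAt]
    intro y
    by_cases hy : y ∈ tsupport χ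
    · exact χ.contDiffAt.smul (contDiffAt_fieldInChart h (hsupp hy))
    · refine (contDiffAt_const (c := (0 : EuclideanSpace ℝ (Fin m)))).congr_of_eventuallyEq ?_
      filter_upwards [(isClosed_tsupport χ).isOpen_compl.mem_nhds hy] with z hz
      simp [f, image_eq_zero_of_notMem_tsupport hz]
  have hfc : HasCompactSupport f := χ.hasCompactSupport.smul_right
  obtain ⟨K, C, -, hC⟩ := exists_lipschitz_bounded hf hfc
  obtain ⟨ψ, hψ, hψs, hψd⟩ := exists_smooth_unitFlow hf hfc
  set ε : ℝ := min 1 (r / 6 / (C + 1)) with hε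
  have hε0 : 0 < ε := lt_min one_pos (by positivity)
  have hε1 : Ioo (-ε) ε ⊆ Ioo (-1 : ℝ) 1 :=
    Ioo_subset_Ioo (by linarith [min_le_left 1 (r / 6 / ((C : ℝ) + 1))]) (min_le_left _ _)
  have hstay : ∀ y ∈ Metric.ball (c x₀) (r / 6), ∀ t ∈ Ioo (-ε) ε,
      ψ t y ∈ Metric.ball (c x₀) (r / 3) := by
    intro y hy t ht
    have h1 := norm_flow_sub_le hψ hC y (hε1 ht)
    have h2 : |t| ≤ r / 6 / (C + 1) := (abs_lt.2 ht).le.trans (min_le_right _ _)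
    have h3 : (C : ℝ) * |t| ≤ r / 6 := by
      rw [le_div_iff₀ (by positivity)] at h2
      nlinarith [abs_nonneg t]
    rw [← dist_eq_norm] at h1
    rw [Metric.mem_ball] at hy ⊢
    linarith [dist_triangle (ψ t y) y (c x₀)]
  have hfX : ∀ y ∈ Metric.ball (c x₀) (r / 3), f =ᶠ[𝓝 y] X := by
    intro y hy
    filter_upwards [Metric.isOpen_ball.mem_nhds hy] with z hz
    have : χ z = 1 := χ.one_of_mem_closedBall (Metric.ball_subset_closedBall hz)
    simp [f, this]
  have hbt : ∀ y ∈ Metric.ball (c x₀) (r / 3), y ∈ c.target := fun y hy =>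
    hball (Metric.ball_subset_ball (by linarith) hy)
  refine ⟨ε, hε0, c.source ∩ c ⁻¹' Metric.ball (c x₀) (r / 6),
    (continuousOn_extChartAt x₀).isOpen_inter_preimage (isOpen_extChartAt_source x₀)
      Metric.isOpen_ball, ⟨mem_extChartAt_source x₀, Metric.mem_ball_self (by positivity)⟩,
    fun t x => c.symm (ψ t (c x)), fun x hx => ?_⟩
  have hst := hstay (c x) hx.2
  refine ⟨by simp only [hψ.zero]; exact c.left_inv hx.1, fun t ht => ?_, fun t ht => ?_⟩
  · have hyt := hbt _ (hst t ht)
    have h1 : HasDerivAt (fun s => ψ s (c x)) (X (ψ t (c x))) t := by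
      have := hψ.hasDerivAt (c x) t (hε1 ht)
      rwa [(hfX _ (hst t ht)).self_of_nhds] at this
    have h2 : HasMFDerivAt 𝓘(ℝ, EuclideanSpace ℝ (Fin m)) (𝓡 m) c.symm (ψ t (c x))
        (dchartSymm x₀ (ψ t (c x))) :=
      ((contMDiffAt_chart_symm hyt).mdifferentiableAt (by simp)).hasMFDerivAt
    have h3 := h2.comp t h1.hasFDerivAt.hasMFDerivAt
    refine (h3.congr_mfderiv ?_).hasMFDerivWithinAt
    refine ContinuousLinearMap.ext_ring ?_
    have := dchartSymm_dchart hyt (liouvilleField lam (c.symm (ψ t (c x))))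
    change dchartSymm x₀ (ψ t (c x)) ((1 : ℝ) • X (ψ t (c x))) =
      (1 : ℝ) • liouvilleField lam (c.symm (ψ t (c x)))
    rw [one_smul, one_smul]
    exact this
  · have hyt := hbt _ (hst t ht)
    have h1 : ContMDiffAt 𝓘(ℝ, EuclideanSpace ℝ (Fin m)) 𝓘(ℝ, EuclideanSpace ℝ (Fin m)) ∞
      (ψ t) (c x) := (hψs t (hε1 ht)).contDiffAt.contMDiffAt
    have h2 := contMDiffAt_chart hx.1
    have h3 : ContMDiffAt (𝓡 m) 𝓘(ℝ, EuclideanSpace ℝ (Fin m)) ∞ (fun z => ψ t (c z)) x :=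
      h1.comp x h2
    have h4 := contMDiffAt_chart_symm hyt
    refine ⟨h4.comp x h3, fun v => ?_⟩
    set w := dchart x₀ x v with hw
    -- `u s` is the form pulled back by the time-`s` flow, evaluated at `w`. By `lieDeriv_inChart`
    -- it solves `u' = u`.
    let u : ℝ → ℝ := fun s => lam.inChart x₀ (ψ s (c x)) (fderiv ℝ (ψ s) (c x) w)
    have hu : ∀ s ∈ Ioo (-ε) ε, HasDerivAt u (u s) s := by
      intro s hs
      have hys := hbt _ (hst s hs)
      have e0 := hfX _ (hst s hs)
      have d1 := ((lam.contDiffAt_inChart x₀ hys).differentiableAt (by simp)).hasFDerivAt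
        |>.comp_hasDerivAt s (hψ.hasDerivAt (c x) s (hε1 hs))
      have d2 := ((hψd (c x)).2 s (hε1 hs)).clm_apply (hasDerivAt_const s w)
      have d3 := d1.clm_apply d2
      refine d3.congr_deriv ?_
      have e1 := lieDeriv_inChart h hys (fderiv ℝ (ψ s) (c x) w)
      rw [e0.self_of_nhds, e0.fderiv_eq]
      simpa using e1
    have hut := eq_exp_mul_of_hasDerivAt hu ht
    have hu0 : u 0 = lam.eval x v := by
      simp only [u, hψ.zero, (hψd (c x)).1]
      exact lam.inChart_mfderiv hx.1 v
    rw [← hu0, ← hut]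
    have m1 : mfderiv (𝓡 m) (𝓡 m) (fun x => c.symm (ψ t (c x))) x v =
        dchartSymm x₀ (ψ t (c x)) (fderiv ℝ (ψ t) (c x) w) := by
      have a1 := mfderiv_comp_apply x (h4.mdifferentiableAt (by simp))
        (h3.mdifferentiableAt (by simp)) v
      have a2 := mfderiv_comp_apply x (h1.mdifferentiableAt (by simp))
        (h2.mdifferentiableAt (by simp)) v
      rw [mfderiv_eq_fderiv] at a2
      exact a1.trans (congrArg _ a2)
    rw [m1]
    rfl

end

/-! ### The flow as a relation: composition, uniqueness, smoothness -/

section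

section Curves

variable {m : ℕ} {M : Type*} [TopologicalSpace M]
  [ChartedSpace (EuclideanSpace ℝ (Fin m)) M]

theorem isMIntegralCurveOn_shift {γ : ℝ → M} {X : ∀ x : M, TangentSpace (𝓡 m) x} {s s' : Set ℝ}
    (h : IsMIntegralCurveOn (I := 𝓡 m) γ X s) (r : ℝ) (hs : ∀ t ∈ s', t + r ∈ s) :
    IsMIntegralCurveOn (I := 𝓡 m) (fun t => γ (t + r)) X s' :=
  (h.comp_add r).mono hs

/-- Gluing two integral curves at an endpoint. -/
theorem isMIntegralCurveOn_glue {γ γ' : ℝ → M} {X : ∀ x : M, TangentSpace (𝓡 m) x} {A B : Set ℝ}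
    {b : ℝ} (hA : A ⊆ Iic b) (hB : B ⊆ Ici b) (hbA : b ∈ A) (hbB : b ∈ B)
    (h : IsMIntegralCurveOn (I := 𝓡 m) γ X A) (h' : IsMIntegralCurveOn (I := 𝓡 m) γ' X B)
    (hb : γ b = γ' b) :
    IsMIntegralCurveOn (I := 𝓡 m) (fun t => if t ≤ b then γ t else γ' t) X (A ∪ B) := by
  set Γ : ℝ → M := fun t => if t ≤ b then γ t else γ' t with hΓ
  have e1 : ∀ t ∈ A, Γ t = γ t := fun t ht => if_pos (hA ht)
  have e2 : ∀ t ∈ B, Γ t = γ' t := by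
    intro t ht
    rcases eq_or_lt_of_le (show b ≤ t from hB ht) with h | h
    · rw [← h, e1 b hbA, hb]
    · exact if_neg (not_le.2 h)
  have hA' : IsMIntegralCurveOn (I := 𝓡 m) Γ X A := fun t ht => by
    rw [e1 t ht]
    exact (h t ht).congr_of_eventuallyEq
      (eventually_of_mem self_mem_nhdsWithin fun s hs => e1 s hs) (e1 t ht)
  have hB' : IsMIntegralCurveOn (I := 𝓡 m) Γ X B := fun t ht => by
    rw [e2 t ht]
    exact (h' t ht).congr_of_eventuallyEq
      (eventually_of_mem self_mem_nhdsWithin fun s hs => e2 s hs) (e2 t ht)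
  intro t ht
  rcases lt_trichotomy t b with hlt | rfl | hlt
  · have htA : t ∈ A := ht.resolve_right fun h => absurd (show b ≤ _ from hB h) (not_le.2 hlt)
    refine (hA' t htA).mono_of_mem_nhdsWithin ?_
    filter_upwards [self_mem_nhdsWithin, mem_nhdsWithin_of_mem_nhds (Iio_mem_nhds hlt)] with s hs hs'
    exact hs.resolve_right fun h => absurd (show b ≤ _ from hB h) (not_le.2 hs')
  · exact (hA' t hbA).union (hB' t hbB)
  · have htB : t ∈ B := ht.resolve_left fun h => absurd (show _ ≤ b from hA h) (not_le.2 hlt)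
    refine (hB' t htB).mono_of_mem_nhdsWithin ?_
    filter_upwards [self_mem_nhdsWithin, mem_nhdsWithin_of_mem_nhds (Ioi_mem_nhds hlt)] with s hs hs'
    exact hs.resolve_left fun h => absurd (show _ ≤ b from hA h) (not_le.2 hs')

end Curves

variable {m : ℕ} {M : Type*} [TopologicalSpace M]
  [ChartedSpace (EuclideanSpace ℝ (Fin m)) M] [IsManifold (𝓡 m) ∞ M] {lam : OneForm m M}

/-- The time-`t` flow of the Liouville field of `lam` is defined at `x` and takes `x` to `y`. -/
def FlowRel (lam : OneForm m M) (t : ℝ) (x y : M) : Prop :=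
  ∃ (γ : ℝ → M) (a b : ℝ), 0 ∈ Ioo a b ∧ t ∈ Ioo a b ∧
    IsMIntegralCurveOn (I := 𝓡 m) γ (liouvilleField lam) (Ioo a b) ∧ γ 0 = x ∧ γ t = y

theorem flowRel_of_curve {γ : ℝ → M} {a b s t : ℝ}
    (h : IsMIntegralCurveOn (I := 𝓡 m) γ (liouvilleField lam) (Ioo a b)) (hs : s ∈ Ioo a b)
    (ht : t ∈ Ioo a b) : FlowRel lam (t - s) (γ s) (γ t) :=
  ⟨fun r => γ (r + s), a - s, b - s, ⟨by linarith [hs.1], by linarith [hs.2]⟩,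
    ⟨by linarith [ht.1], by linarith [ht.2]⟩,
    isMIntegralCurveOn_shift h s fun r hr => ⟨by linarith [hr.1], by linarith [hr.2]⟩,
    by simp, by simp⟩

theorem FlowRel.symm {t : ℝ} {x y : M} (h : FlowRel lam t x y) : FlowRel lam (-t) y x := by
  obtain ⟨γ, a, b, h0, ht, hγ, rfl, rfl⟩ := h
  simpa using flowRel_of_curve hγ ht h0

theorem exists_curve (h : IsExactSymplectic lam) (x : M) : ∃ ε > 0, ∃ γ : ℝ → M, γ 0 = x ∧
    IsMIntegralCurveOn (I := 𝓡 m) γ (liouvilleField lam) (Ioo (-ε) ε) := by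
  obtain ⟨ε, hε, N, hN, hx, φ, hφ⟩ := exists_local_flow h x
  exact ⟨ε, hε, fun t => φ t x, (hφ x hx).1, (hφ x hx).2.1⟩

theorem FlowRel.refl (h : IsExactSymplectic lam) (x : M) : FlowRel lam 0 x x := by
  obtain ⟨ε, hε, γ, h0, hγ⟩ := exists_curve h x
  exact ⟨γ, -ε, ε, by simpa using hε, by simpa using hε, hγ, h0, h0⟩

/-- An integral curve on a closed interval extends to an open one. -/
theorem flowRel_of_Icc (h : IsExactSymplectic lam) {γ : ℝ → M} {t : ℝ} (ht : 0 ≤ t)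
    (hγ : IsMIntegralCurveOn (I := 𝓡 m) γ (liouvilleField lam) (Icc 0 t)) :
    FlowRel lam t (γ 0) (γ t) := by
  obtain ⟨ε₁, hε₁, α, hα0, hα⟩ := exists_curve h (γ 0)
  obtain ⟨ε₂, hε₂, β, hβ0, hβ⟩ := exists_curve h (γ t)
  have g1 := isMIntegralCurveOn_glue (A := Ioc (-ε₁) 0) (B := Icc 0 t) (b := 0)
    (fun s hs => hs.2) (fun s hs => hs.1) ⟨by linarith, le_rfl⟩ ⟨le_rfl, ht⟩
    (hα.mono fun s hs => ⟨hs.1, by linarith [hs.2]⟩) hγ hα0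
  set Γ : ℝ → M := fun s => if s ≤ 0 then α s else γ s with hΓ
  have hΓ0 : Γ 0 = γ 0 := by simp [hΓ, hα0]
  have hΓt : Γ t = γ t := by
    rcases eq_or_lt_of_le ht with h | h
    · rw [← h]; exact hΓ0
    · exact if_neg (not_le.2 h)
  have hβ' : IsMIntegralCurveOn (I := 𝓡 m) (fun s => β (s + -t)) (liouvilleField lam)
      (Ico t (t + ε₂)) :=
    isMIntegralCurveOn_shift hβ (-t) fun s hs => ⟨by linarith [hs.1], by linarith [hs.2]⟩
  have g2 := isMIntegralCurveOn_glue (A := Ioc (-ε₁) 0 ∪ Icc 0 t) (B := Ico t (t + ε₂)) (b := t)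
    (by rintro s (hs | hs); exacts [hs.2.trans ht, hs.2]) (fun s hs => hs.1) (Or.inr ⟨ht, le_rfl⟩)
    ⟨le_rfl, by linarith⟩ g1 hβ' (by simp [hΓt, hβ0])
  refine ⟨_, -ε₁, t + ε₂, ⟨by linarith, by linarith⟩, ⟨by linarith, by linarith⟩,
    g2.mono ?_, ?_, ?_⟩
  · intro s hs
    rcases le_or_gt s 0 with h1 | h1
    · exact Or.inl (Or.inl ⟨hs.1, h1⟩)
    rcases le_or_gt s t with h2 | h2
    · exact Or.inl (Or.inr ⟨h1.le, h2⟩)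
    · exact Or.inr ⟨h2.le, hs.2⟩
  · simp only [ht, if_true, hΓ0]
  · simp only [le_refl, if_true, hΓt]

/-- Allows work with curves on open intervals, which can be reversed and concatenated. The endpoints
are exchanged, so times become nonnegative. -/
theorem flowsTo_iff (h : IsExactSymplectic lam) {t : ℝ} (ht : 0 ≤ t) {x y : M} :
    FlowsTo lam (-t) y x ↔ FlowRel lam t x y := by
  constructor
  · rintro ⟨γ, h0, h1, hγ⟩
    have := flowRel_of_Icc h ht (γ := fun s => γ (s + -t))
      (isMIntegralCurveOn_shift hγ (-t) fun s hs => ⟨by linarith [hs.1], by linarith [hs.2]⟩)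
    simpa [h0, h1] using this
  · rintro ⟨γ, a, b, h0, h1, hγ, rfl, rfl⟩
    refine ⟨fun s => γ (s + t), by simp, by simp, isMIntegralCurveOn_shift hγ t fun s hs =>
      ⟨by linarith [hs.1, h0.1], by linarith [hs.2, h1.2]⟩⟩

theorem contMDiff_one_liouvilleField (h : IsExactSymplectic lam) :
    ContMDiff (𝓡 m) (𝓡 m).tangent 1
      (fun x => (⟨x, liouvilleField lam x⟩ : TangentBundle (𝓡 m) M)) :=
  (contMDiff_liouvilleField h).of_le ENat.LEInfty.out

variable [T2Space M]

theorem FlowRel.unique (h : IsExactSymplectic lam) {t : ℝ} {x y y' : M} (h1 : FlowRel lam t x y)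
    (h2 : FlowRel lam t x y') : y = y' := by
  obtain ⟨γ, a, b, h0, ht, hγ, hx, rfl⟩ := h1
  obtain ⟨γ', a', b', h0', ht', hγ', hx', rfl⟩ := h2
  have : IsManifold (𝓡 m) 1 M := IsManifold.of_le (n := ∞) ENat.LEInfty.out
  exact isMIntegralCurveOn_Ioo_eqOn_of_contMDiff_boundaryless (t₀ := 0) (a := max a a')
    (b := min b b') ⟨max_lt h0.1 h0'.1, lt_min h0.2 h0'.2⟩ (contMDiff_one_liouvilleField h)
    (hγ.mono (Ioo_subset_Ioo (le_max_left ..) (min_le_left ..)))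
    (hγ'.mono (Ioo_subset_Ioo (le_max_right ..) (min_le_right ..))) (hx.trans hx'.symm)
    ⟨max_lt ht.1 ht'.1, lt_min ht.2 ht'.2⟩

theorem FlowRel.unique_left (h : IsExactSymplectic lam) {t : ℝ} {x x' y : M}
    (h1 : FlowRel lam t x y) (h2 : FlowRel lam t x' y) : x = x' :=
  h1.symm.unique h h2.symm

theorem FlowRel.trans (h : IsExactSymplectic lam) {s t : ℝ} {x y z : M} (h1 : FlowRel lam s x y)
    (h2 : FlowRel lam t y z) : FlowRel lam (s + t) x z := by
  obtain ⟨γ, a, b, h0, hs, hγ, rfl, rfl⟩ := h1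
  obtain ⟨γ', a', b', h0', ht, hγ', hy, rfl⟩ := h2
  have : IsManifold (𝓡 m) 1 M := IsManifold.of_le (n := ∞) ENat.LEInfty.out
  set β : ℝ → M := fun r => γ' (r + -s) with hβ
  have hβc : IsMIntegralCurveOn (I := 𝓡 m) β (liouvilleField lam) (Ioo (a' + s) (b' + s)) :=
    isMIntegralCurveOn_shift hγ' (-s) fun r hr => ⟨by linarith [hr.1], by linarith [hr.2]⟩
  have hs' : s ∈ Ioo (a' + s) (b' + s) := ⟨by linarith [h0'.1], by linarith [h0'.2]⟩
  have hβs : γ s = β s := by simp [hβ, hy]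
  have hst : s + t ∈ Ioo (a' + s) (b' + s) := ⟨by linarith [ht.1], by linarith [ht.2]⟩
  have e := isMIntegralCurveOn_piecewise (contMDiff_one_liouvilleField h) hγ hβc ⟨hs, hs'⟩ hβs
  have e2 := eqOn_piecewise_of_isMIntegralCurveOn_Ioo (contMDiff_one_liouvilleField h) hγ hβc
    ⟨hs, hs'⟩ hβs hst
  rw [Ioo_union_Ioo' (by linarith [hs.2, h0'.1]) (by linarith [hs.1, h0'.2])] at e
  refine ⟨_, _, _, ⟨min_lt_iff.2 (Or.inl h0.1), lt_max_iff.2 (Or.inl h0.2)⟩,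
    ⟨min_lt_iff.2 (Or.inr hst.1), lt_max_iff.2 (Or.inr hst.2)⟩, e, ?_, ?_⟩
  · rw [piecewise_eq_of_mem _ _ _ h0]
  · rw [e2]
    simp [hβ]

/-- The time-`t` Liouville flow near `x`: a smooth map `φ`, given by the flow, which scales the
`1`-form by `exp t`. -/
def FlowGerm (lam : OneForm m M) (t : ℝ) (φ : M → M) (x : M) : Prop :=
  ∀ᶠ z in 𝓝 x, ContMDiffAt (𝓡 m) (𝓡 m) ∞ φ z ∧ FlowRel lam t z (φ z) ∧
    ∀ v : TangentSpace (𝓡 m) z,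
      lam.eval (φ z) (mfderiv (𝓡 m) (𝓡 m) φ z v) = Real.exp t * lam.eval z v

theorem FlowGerm.comp (h : IsExactSymplectic lam) {s t : ℝ} {φ ψ : M → M} {x : M}
    (hψ : FlowGerm lam t ψ (φ x)) (hφ : FlowGerm lam s φ x) :
    FlowGerm lam (s + t) (ψ ∘ φ) x := by
  filter_upwards [hφ, hφ.self_of_nhds.1.continuousAt.eventually hψ] with z ⟨a1, a2, a3⟩ ⟨b1, b2, b3⟩
  refine ⟨b1.comp z a1, a2.trans h b2, fun v => ?_⟩
  have := mfderiv_comp_apply z (b1.mdifferentiableAt (by simp)) (a1.mdifferentiableAt (by simp)) v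
  rw [this, Function.comp_apply, b3, a3, Real.exp_add]
  ring

/-- The flow is smooth wherever it is defined. -/
theorem FlowRel.exists_germ (h : IsExactSymplectic lam) {t : ℝ} {x y : M}
    (hxy : FlowRel lam t x y) : ∃ φ : M → M, φ x = y ∧ FlowGerm lam t φ x := by
  suffices ∃ φ : M → M, FlowGerm lam t φ x by
    obtain ⟨φ, hφ⟩ := this
    exact ⟨φ, hφ.self_of_nhds.2.1.unique h hxy, hφ⟩
  obtain ⟨γ, a, b, h0, ht, hγ, rfl, rfl⟩ := hxy
  -- Local flows supply germs between nearby points of the curve, in both time directions. Composing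
  -- germs makes the relation transitive, so connectedness of the interval suffices.
  have key := (isPreconnected_Ioo (a := a) (b := b)).induction₂'
    (fun s₁ s₂ => ∃ φ : M → M, FlowGerm lam (s₂ - s₁) φ (γ s₁)) ?_ ?_ h0 ht
  · simpa using key
  · intro s hs
    obtain ⟨ε, hε, N, hN, hx, φ, hφ⟩ := exists_local_flow h (γ s)
    have hgerm : ∀ r ∈ Ioo (-ε) ε, ∀ z ∈ N, FlowGerm lam r (φ r) z := by
      intro r hr z hz
      filter_upwards [hN.mem_nhds hz] with w hw
      obtain ⟨w1, w2, w3⟩ := hφ w hw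
      exact ⟨(w3 r hr).1, ⟨fun t => φ t w, -ε, ε, by simpa using hε, hr, w2, w1, rfl⟩,
        (w3 r hr).2⟩
    have hcont : ContinuousWithinAt γ (Ioo a b) s := hγ.continuousWithinAt hs
    have hnear : ∀ᶠ r in 𝓝[Ioo a b] s, |r - s| < ε := by
      refine mem_nhdsWithin_of_mem_nhds ?_
      filter_upwards [Ioo_mem_nhds (show s - ε < s by linarith) (show s < s + ε by linarith)]
        with r hr
      rw [abs_lt]
      constructor <;> linarith [hr.1, hr.2]
    filter_upwards [hcont.eventually (hN.mem_nhds hx), hnear] with r hr1 hr2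
    have hr3 := abs_lt.1 hr2
    exact ⟨⟨_, hgerm _ hr3 _ hx⟩, ⟨_, hgerm (s - r) ⟨by linarith [hr3.2], by linarith [hr3.1]⟩ _ hr1⟩⟩
  · rintro s₁ s₂ s₃ h1 h2 h3 ⟨φ, hφ⟩ ⟨ψ, hψ⟩
    have e : φ (γ s₁) = γ s₂ := hφ.self_of_nhds.2.1.unique h (flowRel_of_curve hγ h1 h2)
    refine ⟨ψ ∘ φ, ?_⟩
    rw [← e] at hψ
    simpa using hψ.comp h hφ

end

/-! ### Topology of the scalings -/

section

section Scaling

variable {m : ℕ} {M : Type*} [TopologicalSpace M]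
  [ChartedSpace (EuclideanSpace ℝ (Fin m)) M] [IsManifold (𝓡 m) ∞ M] {lam : OneForm m M}

theorem mem_flowImage_iff (h : IsExactSymplectic lam) {σ : ℝ} (hσ : 0 ≤ σ) {x : M} :
    x ∈ flowImage lam (-σ) ↔ ∃ y, FlowRel lam σ x y :=
  exists_congr fun _ => flowsTo_iff h hσ

theorem IsOpenLiouvilleDomain.exists_flowRel (h : IsOpenLiouvilleDomain lam) {σ : ℝ} (hσ : 0 ≤ σ)
    (y : M) : ∃ x, FlowRel lam σ x y := by
  obtain ⟨x, hx⟩ := h.flow_exists (-σ) (by linarith) y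
  exact ⟨x, (flowsTo_iff h.exactSymplectic hσ).1 hx⟩

theorem FlowRel.exists_of_le {s t : ℝ} {x y : M} (h : FlowRel lam t x y) (hs : 0 ≤ s)
    (hst : s ≤ t) : ∃ z, FlowRel lam s x z := by
  obtain ⟨γ, a, b, h0, ht, hγ, rfl, rfl⟩ := h
  exact ⟨γ s, γ, a, b, h0, ⟨by linarith [h0.1], by linarith [ht.2]⟩, hγ, rfl, rfl⟩

theorem isCompact_closure_flowImage (h : IsOpenLiouvilleDomain lam) {σ : ℝ} (hσ : 0 < σ) :
    IsCompact (closure (flowImage lam (-σ))) :=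
  h.isCompact_closure _ (by linarith)

theorem flowImage_subset (h : IsExactSymplectic lam) {σ τ : ℝ} (hσ : 0 ≤ σ) (hστ : σ ≤ τ) :
    flowImage lam (-τ) ⊆ flowImage lam (-σ) := by
  intro x hx
  obtain ⟨y, hy⟩ := (mem_flowImage_iff h (hσ.trans hστ)).1 hx
  exact (mem_flowImage_iff h hσ).2 (hy.exists_of_le hσ hστ)

/-- The curve lives on an open interval, so it runs a little beyond time `σ`. -/
theorem exists_mem_flowImage_add (h : IsExactSymplectic lam) {σ : ℝ} (hσ : 0 ≤ σ) {x : M}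
    (hx : x ∈ flowImage lam (-σ)) : ∃ η > 0, x ∈ flowImage lam (-(σ + η)) := by
  obtain ⟨y, γ, a, b, h0, ht, hγ, rfl, rfl⟩ := (mem_flowImage_iff h hσ).1 hx
  refine ⟨(b - σ) / 2, by linarith [ht.2], (mem_flowImage_iff h (by linarith [ht.2])).2
    ⟨_, γ, a, b, h0, ⟨by linarith [ht.1, ht.2], by linarith [ht.2]⟩, hγ, rfl, rfl⟩⟩

theorem flowImage_zero (h : IsExactSymplectic lam) : flowImage lam (-0) = univ :=
  eq_univ_of_forall fun x => (mem_flowImage_iff h le_rfl).2 ⟨x, FlowRel.refl h x⟩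

variable [T2Space M]

theorem FlowRel.mem_flowImage_iff (h : IsExactSymplectic lam) {s σ : ℝ} (hs : 0 ≤ s) (hσ : 0 ≤ σ)
    {x y : M} (hxy : FlowRel lam s x y) :
    x ∈ flowImage lam (-(σ + s)) ↔ y ∈ flowImage lam (-σ) := by
  rw [SymplecticBM.mem_flowImage_iff h hσ, SymplecticBM.mem_flowImage_iff h (by positivity)]
  refine exists_congr fun z => ⟨fun hz => ?_, fun hz => ?_⟩
  · simpa using hxy.symm.trans h hz
  · simpa [add_comm] using hxy.trans h hz

theorem isOpen_flowImage (h : IsExactSymplectic lam) {σ : ℝ} (hσ : 0 ≤ σ) :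
    IsOpen (flowImage lam (-σ)) := by
  rw [isOpen_iff_mem_nhds]
  intro x hx
  obtain ⟨y, hy⟩ := (mem_flowImage_iff h hσ).1 hx
  obtain ⟨φ, -, hφ⟩ := hy.exists_germ h
  filter_upwards [hφ] with z hz
  exact (mem_flowImage_iff h hσ).2 ⟨_, hz.2.1⟩

/-- The smaller image lies in the time `-σ` flow of the closure of `flowImage lam (-η)`. That set is
compact, hence closed, and is contained in the larger image. -/
theorem closure_flowImage_subset (h : IsOpenLiouvilleDomain lam) {σ η : ℝ} (hσ : 0 ≤ σ)
    (hη : 0 < η) : closure (flowImage lam (-(σ + η))) ⊆ flowImage lam (-σ) := by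
  have hs := h.exactSymplectic
  choose ψ hψ using fun y => h.exists_flowRel hσ y
  have hcont : Continuous ψ := by
    rw [continuous_iff_continuousAt]
    intro y
    obtain ⟨φ, -, hφ⟩ := (hψ y).symm.exists_germ hs
    refine hφ.self_of_nhds.1.continuousAt.congr ?_
    filter_upwards [hφ] with z hz
    exact hz.2.1.unique hs (hψ z).symm
  have hc := (h.isCompact_closure (-η) (by linarith)).image hcont
  refine (closure_minimal ?_ hc.isClosed).trans ?_
  · intro x hx
    obtain ⟨z, hz⟩ := (mem_flowImage_iff hs (by positivity)).1 hx
    obtain ⟨y, hy⟩ := hz.exists_of_le hσ (by linarith)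
    refine ⟨y, subset_closure ?_, (hψ y).unique_left hs hy⟩
    rw [← hy.mem_flowImage_iff hs hσ hη.le, add_comm]
    exact hx
  · rintro _ ⟨y, -, rfl⟩
    exact (mem_flowImage_iff hs hσ).2 ⟨y, hψ y⟩

end Scaling

section Differential

variable {m : ℕ} {M : Type*} [TopologicalSpace M] [ChartedSpace (EuclideanSpace ℝ (Fin m)) M]

/-- The differential of a real function, with real values. -/
def dReal (f : M → ℝ) (x : M) : TangentSpace (𝓡 m) x →L[ℝ] ℝ := mfderiv (𝓡 m) 𝓘(ℝ, ℝ) f x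

theorem dReal_add {f g : M → ℝ} {x : M} (hf : ContMDiffAt (𝓡 m) 𝓘(ℝ, ℝ) ∞ f x)
    (hg : ContMDiffAt (𝓡 m) 𝓘(ℝ, ℝ) ∞ g x) (v : TangentSpace (𝓡 m) x) :
    dReal (fun y => f y + g y) x v = dReal f x v + dReal g x v :=
  DFunLike.congr_fun (((hf.mdifferentiableAt (by simp)).hasMFDerivAt.add
    (hg.mdifferentiableAt (by simp)).hasMFDerivAt).mfderiv) v

theorem dReal_const_mul {f : M → ℝ} {x : M} (hf : ContMDiffAt (𝓡 m) 𝓘(ℝ, ℝ) ∞ f x) (c : ℝ)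
    (v : TangentSpace (𝓡 m) x) : dReal (fun y => c * f y) x v = c * dReal f x v :=
  DFunLike.congr_fun
    (((hf.mdifferentiableAt (by simp)).hasMFDerivAt.const_smul c).mfderiv) v

theorem dReal_comp {k : ℕ} {N : Type*} [TopologicalSpace N]
    [ChartedSpace (EuclideanSpace ℝ (Fin k)) N] {F : M → N} {g : N → ℝ} {x : M}
    (hg : ContMDiffAt (𝓡 k) 𝓘(ℝ, ℝ) ∞ g (F x)) (hF : ContMDiffAt (𝓡 m) (𝓡 k) ∞ F x)
    (v : TangentSpace (𝓡 m) x) :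
    dReal (fun y => g (F y)) x v = dReal g (F x) (mfderiv (𝓡 m) (𝓡 k) F x v) :=
  mfderiv_comp_apply x (hg.mdifferentiableAt (by simp)) (hF.mdifferentiableAt (by simp)) v

end Differential

/-! ### Exact maps and Liouville embeddings -/

section Embedding

variable {n : ℕ}
  {U : Type*} [TopologicalSpace U] [ChartedSpace (EuclideanSpace ℝ (Fin (2 * n))) U]
  [IsManifold (𝓡 (2 * n)) ∞ U]
  {V : Type*} [TopologicalSpace V] [ChartedSpace (EuclideanSpace ℝ (Fin (2 * n))) V]
  [IsManifold (𝓡 (2 * n)) ∞ V]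
  {W : Type*} [TopologicalSpace W] [ChartedSpace (EuclideanSpace ℝ (Fin (2 * n))) W]
  [IsManifold (𝓡 (2 * n)) ∞ W]
  {lam : OneForm (2 * n) U} {mu : OneForm (2 * n) V} {nu : OneForm (2 * n) W}

/-- `F^* mu - lam = df` on `S`, where `F` and `f` are smooth on a neighbourhood of `S`. -/
def PullsBackOn (lam : OneForm (2 * n) U) (mu : OneForm (2 * n) V) (S : Set U) (F : U → V)
    (f : U → ℝ) : Prop :=
  ∀ x ∈ S, ContMDiffAt (𝓡 (2 * n)) (𝓡 (2 * n)) ∞ F x ∧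
    ContMDiffAt (𝓡 (2 * n)) 𝓘(ℝ, ℝ) ∞ f x ∧
    ∀ v : TangentSpace (𝓡 (2 * n)) x,
      mu.eval (F x) (mfderiv (𝓡 (2 * n)) (𝓡 (2 * n)) F x v) - lam.eval x v =
        dReal f x v

theorem PullsBackOn.d_eq {S : Set U} (hS : IsOpen S) {F : U → V} {f : U → ℝ}
    (hF : PullsBackOn lam mu S F f) {x : U} (hx : x ∈ S) (v w : TangentSpace (𝓡 (2 * n)) x) :
    mu.d (F x) ![mfderiv (𝓡 (2 * n)) (𝓡 (2 * n)) F x v, mfderiv (𝓡 (2 * n)) (𝓡 (2 * n)) F x w] =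
      lam.d x ![v, w] :=
  d_pullback (eventually_of_mem (hS.mem_nhds hx) fun z hz => (hF z hz).1)
    (eventually_of_mem (hS.mem_nhds hx) fun z hz => (hF z hz).2.1)
    (eventually_of_mem (hS.mem_nhds hx) fun z hz => (hF z hz).2.2) v w

/-- Since `F` pulls `d mu` back to `d lam`, a vector in the kernel of its derivative pairs to zero
with everything. -/
theorem PullsBackOn.injective_mfderiv (h : IsExactSymplectic lam) {S : Set U} (hS : IsOpen S)
    {F : U → V} {f : U → ℝ} (hF : PullsBackOn lam mu S F f) {x : U} (hx : x ∈ S) :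
    Function.Injective (mfderiv (𝓡 (2 * n)) (𝓡 (2 * n)) F x) := by
  rw [injective_iff_map_eq_zero]
  intro v hv
  refine h x v fun w => ?_
  rw [← hF.d_eq hS hx, hv]
  have := d_smul_left mu (F x) 0 0 (mfderiv (𝓡 (2 * n)) (𝓡 (2 * n)) F x w)
  rwa [zero_smul, zero_mul] at this

theorem nhds_le_map_of_localInverse {F : U → V} {x : U}
    (hF : ContMDiffAt (𝓡 (2 * n)) (𝓡 (2 * n)) ∞ F x)
    (hinj : Function.Injective (mfderiv (𝓡 (2 * n)) (𝓡 (2 * n)) F x)) :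
    𝓝 (F x) ≤ map F (𝓝 x) := by
  obtain ⟨j, hj, hj0, hjr, -⟩ := exists_localInverse hF hinj
  intro A hA
  have hcont : Tendsto j (𝓝 (F x)) (𝓝 x) := by
    have := hj.continuousAt
    rwa [ContinuousAt, hj0] at this
  filter_upwards [hjr, hcont.eventually hA] with w hw hw'
  rw [← hw]
  exact hw'

/-- The dimensions are equal, so an exact map is a local diffeomorphism, hence open. Injectivity is
then all that an embedding requires. -/
theorem PullsBackOn.isLiouvilleEmbeddingOn (h : IsExactSymplectic lam) {S : Set U} (hS : IsOpen S)
    {F : U → V} {f : U → ℝ} (hF : PullsBackOn lam mu S F f) (hinj : InjOn F S) :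
    IsLiouvilleEmbeddingOn lam mu S F where
  contMDiffOn := fun x hx => (hF x hx).1.contMDiffWithinAt
  isEmbedding := by
    refine (Topology.IsOpenEmbedding.of_continuous_injective_isOpenMap ?_ ?_ ?_).isEmbedding
    · exact continuousOn_iff_continuous_domRestrict.1
        fun x hx => (hF x hx).1.continuousAt.continuousWithinAt
    · exact injOn_iff_injective.1 hinj
    · rw [isOpenMap_iff_nhds_le]
      rintro ⟨x, hx⟩
      have h1 := nhds_le_map_of_localInverse (hF x hx).1 (hF.injective_mfderiv h hS hx)
      rw [← map_nhds_subtype_coe_eq_nhds hx (hS.mem_nhds hx), map_map] at h1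
      exact h1
  injective_mfderiv := fun x hx => hF.injective_mfderiv h hS hx
  exact_sub := ⟨f, fun x hx => (hF x hx).2.1.contMDiffWithinAt, fun x hx => (hF x hx).2.2⟩

theorem IsLiouvilleEmbeddingOn.injOn {S : Set U} {F : U → V}
    (hF : IsLiouvilleEmbeddingOn lam mu S F) : InjOn F S :=
  injOn_iff_injective.2 hF.isEmbedding.injective

theorem IsLiouvilleEmbeddingOn.pullsBackOn {S : Set U} (hS : IsOpen S) {F : U → V}
    (hF : IsLiouvilleEmbeddingOn lam mu S F) : ∃ f, PullsBackOn lam mu S F f := by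
  obtain ⟨f, hf, he⟩ := hF.exact_sub
  exact ⟨f, fun x hx => ⟨hF.contMDiffOn.contMDiffAt (hS.mem_nhds hx),
    hf.contMDiffAt (hS.mem_nhds hx), he x hx⟩⟩

theorem PullsBackOn.comp {S : Set U} {T : Set V} {F : U → V} {G : V → W} {f : U → ℝ} {g : V → ℝ}
    (hG : PullsBackOn mu nu T G g) (hF : PullsBackOn lam mu S F f) (hST : MapsTo F S T) :
    PullsBackOn lam nu S (G ∘ F) (fun x => g (F x) + f x) := by
  intro x hx
  obtain ⟨a1, a2, a3⟩ := hF x hx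
  obtain ⟨b1, b2, b3⟩ := hG (F x) (hST hx)
  have c2 : ContMDiffAt (𝓡 (2 * n)) 𝓘(ℝ, ℝ) ∞ (fun x => g (F x)) x := b2.comp x a1
  refine ⟨b1.comp x a1, c2.add a2, fun v => ?_⟩
  have e1 := mfderiv_comp_apply x (b1.mdifferentiableAt (by simp)) (a1.mdifferentiableAt (by simp)) v
  rw [e1, dReal_add c2 a2, dReal_comp b2 a1, ← b3, ← a3]
  simp

theorem PullsBackOn.mono {S T : Set U} {F : U → V} {f : U → ℝ} (hF : PullsBackOn lam mu S F f)
    (h : T ⊆ S) : PullsBackOn lam mu T F f := fun x hx => hF x (h hx)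

theorem IsLiouvilleEmbeddingOn.comp (h : IsExactSymplectic lam) {S : Set U} {T : Set V}
    (hS : IsOpen S) (hT : IsOpen T) {F : U → V} {G : V → W}
    (hG : IsLiouvilleEmbeddingOn mu nu T G) (hF : IsLiouvilleEmbeddingOn lam mu S F)
    (hST : MapsTo F S T) : IsLiouvilleEmbeddingOn lam nu S (G ∘ F) := by
  obtain ⟨f, hf⟩ := hF.pullsBackOn hS
  obtain ⟨g, hg⟩ := hG.pullsBackOn hT
  exact (hg.comp hf hST).isLiouvilleEmbeddingOn h hS (hG.injOn.comp hF.injOn hST)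

end Embedding

end

/-! ### Conjugation of embeddings by the flows -/

section

section Conjugation

variable {n : ℕ}
  {U : Type*} [TopologicalSpace U] [ChartedSpace (EuclideanSpace ℝ (Fin (2 * n))) U]
  [IsManifold (𝓡 (2 * n)) ∞ U]
  {V : Type*} [TopologicalSpace V] [ChartedSpace (EuclideanSpace ℝ (Fin (2 * n))) V]
  [IsManifold (𝓡 (2 * n)) ∞ V]
  {lam : OneForm (2 * n) U} {mu : OneForm (2 * n) V}

theorem PullsBackOn.congr {x : U} {F G : U → V} {f g : U → ℝ} (hF : PullsBackOn lam mu {x} F f)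
    (hG : G =ᶠ[𝓝 x] F) (hg : g =ᶠ[𝓝 x] f) : PullsBackOn lam mu {x} G g := by
  intro y hy
  obtain rfl : y = x := hy
  obtain ⟨a1, a2, a3⟩ := hF y rfl
  refine ⟨a1.congr_of_eventuallyEq hG, a2.congr_of_eventuallyEq hg, fun v => ?_⟩
  have e1 : dReal (m := 2 * n) g y = dReal f y := hg.mfderiv_eq
  rw [e1, ← a3, hG.mfderiv_eq, hG.self_of_nhds]

/-- Conjugating by the Liouville flows. -/
theorem PullsBackOn.conj_flow {t : ℝ} {x : U} {φ : U → U} {F : U → V} {f : U → ℝ} {ψ : V → V}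
    (hφ : FlowGerm lam t φ x) (hF : PullsBackOn lam mu {φ x} F f)
    (hψ : FlowGerm mu (-t) ψ (F (φ x))) :
    PullsBackOn lam mu {x} (fun z => ψ (F (φ z))) (fun z => Real.exp (-t) * f (φ z)) := by
  intro y hy
  obtain rfl : y = x := hy
  obtain ⟨a1, -, a3⟩ := hφ.self_of_nhds
  obtain ⟨b1, b2, b3⟩ := hF _ rfl
  obtain ⟨c1, -, c3⟩ := hψ.self_of_nhds
  have d1 : ContMDiffAt (𝓡 (2 * n)) (𝓡 (2 * n)) ∞ (fun z => F (φ z)) y := b1.comp y a1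
  have d2 : ContMDiffAt (𝓡 (2 * n)) 𝓘(ℝ, ℝ) ∞ (fun z => f (φ z)) y := b2.comp y a1
  have d3 : ContMDiffAt (𝓡 (2 * n)) (𝓡 (2 * n)) ∞ (fun z => ψ (F (φ z))) y := c1.comp y d1
  refine ⟨d3, contMDiffAt_const.mul d2, fun v => ?_⟩
  have e1 : mfderiv (𝓡 (2 * n)) (𝓡 (2 * n)) (fun z => F (φ z)) y v =
      mfderiv (𝓡 (2 * n)) (𝓡 (2 * n)) F (φ y) (mfderiv (𝓡 (2 * n)) (𝓡 (2 * n)) φ y v) :=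
    mfderiv_comp_apply y (b1.mdifferentiableAt (by simp)) (a1.mdifferentiableAt (by simp)) v
  have e2 : mfderiv (𝓡 (2 * n)) (𝓡 (2 * n)) (fun z => ψ (F (φ z))) y v =
      mfderiv (𝓡 (2 * n)) (𝓡 (2 * n)) ψ (F (φ y))
        (mfderiv (𝓡 (2 * n)) (𝓡 (2 * n)) (fun z => F (φ z)) y v) :=
    mfderiv_comp_apply y (c1.mdifferentiableAt (by simp)) (d1.mdifferentiableAt (by simp)) v
  have e8 : Real.exp (-t) * Real.exp t = 1 := by rw [← Real.exp_add]; simp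
  rw [e2, c3, e1, dReal_const_mul d2, dReal_comp b2 a1, ← b3, a3]
  linear_combination (lam.eval y v) * e8

variable [T2Space U] [T2Space V]

theorem IsLiouvilleEmbeddingOn.exists_conj_flow (h : IsExactSymplectic lam)
    (h' : IsOpenLiouvilleDomain mu) {σ s : ℝ} (hσ : 0 ≤ σ) (hs : 0 ≤ s) {F : U → V}
    (hF : IsLiouvilleEmbeddingOn lam mu (flowImage lam (-σ)) F) :
    ∃ G : U → V, IsLiouvilleEmbeddingOn lam mu (flowImage lam (-(σ + s))) G ∧
      ∀ x y, y ∈ flowImage lam (-σ) → FlowRel lam s x y → FlowRel mu s (G x) (F y) := by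
  classical
  have hS := isOpen_flowImage h hσ
  obtain ⟨f, hf⟩ := hF.pullsBackOn hS
  -- The value off the scaling is arbitrary. On it the flow is unique, so the pointwise choice
  -- agrees near each point with a smooth germ.
  have hex : ∀ x, ∃ y, x ∈ flowImage lam (-(σ + s)) → FlowRel lam s x y := by
    intro x
    by_cases hx : x ∈ flowImage lam (-(σ + s))
    · obtain ⟨z, hz⟩ := (mem_flowImage_iff h (by positivity)).1 hx
      obtain ⟨y, hy⟩ := hz.exists_of_le hs (by linarith)
      exact ⟨y, fun _ => hy⟩
    · exact ⟨x, fun hx' => absurd hx' hx⟩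
  choose φ hφ using hex
  choose ψ hψ using fun y => h'.exists_flowRel hs y
  have key : ∀ x y, y ∈ flowImage lam (-σ) → FlowRel lam s x y → φ x = y := fun x y hy hxy =>
    (hφ x ((hxy.mem_flowImage_iff h hs hσ).2 hy)).unique h hxy
  refine ⟨fun x => ψ (F (φ x)), ?_, fun x y hy hxy => ?_⟩
  · refine PullsBackOn.isLiouvilleEmbeddingOn h (isOpen_flowImage h (by positivity))
      (f := fun x => Real.exp (-s) * f (φ x)) ?_ ?_
    · intro x hx
      have hxy := hφ x hx
      have hy := (hxy.mem_flowImage_iff h hs hσ).1 hx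
      obtain ⟨φ', hφ', hg⟩ := hxy.exists_germ h
      obtain ⟨ψ', hψ', hg'⟩ := (hψ (F (φ x))).symm.exists_germ h'.exactSymplectic
      rw [← hφ'] at hy hg'
      have := PullsBackOn.conj_flow hg (hf.mono (singleton_subset_iff.2 hy)) hg'
      have e : φ =ᶠ[𝓝 x] φ' := by
        filter_upwards [hg, hg.self_of_nhds.1.continuousAt.eventually (hS.mem_nhds hy)]
          with z hz hz'
        exact key z _ hz' hz.2.1
      refine this.congr ?_ ?_ x rfl
      · have hc : ContinuousAt (fun z => F (φ' z)) x :=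
          ContinuousAt.comp (hf _ hy).1.continuousAt hg.self_of_nhds.1.continuousAt
        filter_upwards [e, hc.eventually hg'] with z hz hz'
        rw [hz]
        exact (hψ _).symm.unique h'.exactSymplectic hz'.2.1
      · filter_upwards [e] with z hz
        rw [hz]
    · intro x hx x' hx' e
      have hy := ((hφ x hx).mem_flowImage_iff h hs hσ).1 hx
      have hy' := ((hφ x' hx').mem_flowImage_iff h hs hσ).1 hx'
      have e1 := hψ (F (φ x))
      have e2 := hψ (F (φ x'))
      simp only at e
      rw [← e] at e2
      have e3 := hF.injOn hy hy' (e1.unique h'.exactSymplectic e2)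
      have e4 := hφ x' hx'
      rw [← e3] at e4
      exact (hφ x hx).unique_left h e4
  · simp only [key x y hy hxy]
    exact hψ _

end Conjugation

end

/-! ### Changing the form by an exact form -/

section

section Perturbation

variable {m : ℕ} {M : Type*} [TopologicalSpace M]
  [ChartedSpace (EuclideanSpace ℝ (Fin m)) M] [IsManifold (𝓡 m) ∞ M]

/-- The `1`-form `dg`. -/
def OneForm.exact (g : M → ℝ) (hg : ContMDiff (𝓡 m) 𝓘(ℝ, ℝ) ∞ g) : OneForm m M where
  toFun x := dReal g x
  contMDiff_toFun := by
    intro x₀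
    rw [contMDiffAt_hom_bundle]
    refine ⟨contMDiffAt_id, ?_⟩
    set c := extChartAt (𝓡 m) x₀ with hc
    have h1 : ContDiffAt ℝ ∞ (fun y => g (c.symm y)) (c x₀) :=
      (hg.contMDiffAt.comp _ (contMDiffAt_chart_symm (mem_extChartAt_target x₀))).contDiffAt
    have h2 : ContMDiffAt 𝓘(ℝ, EuclideanSpace ℝ (Fin m)) 𝓘(ℝ, EuclideanSpace ℝ (Fin m) →L[ℝ] ℝ) ∞
        (fderiv ℝ (fun y => g (c.symm y))) (c x₀) :=
      (h1.fderiv_right (m := ∞) (by simp)).contMDiffAt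
    have h3 := h2.comp x₀ (contMDiffAt_chart (mem_extChartAt_source x₀))
    refine h3.congr_of_eventuallyEq ?_
    filter_upwards [(isOpen_extChartAt_source (I := 𝓡 m) x₀).mem_nhds (mem_extChartAt_source x₀)]
      with z hz
    have hz' : z ∈ (chartAt (EuclideanSpace ℝ (Fin m)) x₀).source := by
      rwa [extChartAt_source] at hz
    refine (inCoordinates_covector hz' (dReal g z)).trans ?_
    have e : c.symm (c z) = z := c.left_inv hz
    ext w
    have h4 := mfderiv_comp_apply (c z) (hg.contMDiffAt.mdifferentiableAt (by simp))
      ((contMDiffAt_chart_symm (x₀ := x₀) (c.map_source hz)).mdifferentiableAt (by simp)) w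
    rw [mfderiv_eq_fderiv] at h4
    have h5 : ∀ z' (hz : z' = z) (u : EuclideanSpace ℝ (Fin m)), dReal g z u = dReal g z' u := by
      rintro z' rfl u; rfl
    exact (h5 _ e _).trans h4.symm

/-- The `1`-form `lam - dg`. -/
def OneForm.subExact (lam : OneForm m M) (g : M → ℝ) (hg : ContMDiff (𝓡 m) 𝓘(ℝ, ℝ) ∞ g) :
    OneForm m M := lam - OneForm.exact g hg

variable {lam : OneForm m M} {g : M → ℝ} {hg : ContMDiff (𝓡 m) 𝓘(ℝ, ℝ) ∞ g}

theorem OneForm.eval_subExact (x : M) (v : TangentSpace (𝓡 m) x) :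
    (lam.subExact g hg).eval x v = lam.eval x v - dReal g x v := by
  have : (lam.subExact g hg) x = lam x - OneForm.exact g hg x := rfl
  exact (DFunLike.congr_fun this v).trans (sub_apply _ _ _)

/-- The identity map pulls `lam` back to `lam - dg` plus the exact form `dg`, so naturality of `d`
applies. -/
theorem OneForm.d_subExact (x : M) (v w : TangentSpace (𝓡 m) x) :
    (lam.subExact g hg).d x ![v, w] = lam.d x ![v, w] := by
  have := d_pullback (lam := lam.subExact g hg) (mu := lam) (f := id) (g := g) (x := x)
    (Eventually.of_forall fun z => contMDiffAt_id) (Eventually.of_forall fun z => hg z)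
    (Eventually.of_forall fun z v => ?_) v w
  · rw [mfderiv_id] at this
    exact this.symm
  · rw [mfderiv_id, OneForm.eval_subExact]
    exact sub_sub_cancel _ _

theorem IsExactSymplectic.subExact (h : IsExactSymplectic lam) :
    IsExactSymplectic (lam.subExact g hg) := fun x v hv =>
  h x v fun w => by rw [← OneForm.d_subExact (hg := hg)]; exact hv w

theorem liouvilleField_subExact (h : IsExactSymplectic lam) {x : M} (hx : x ∉ tsupport g) :
    liouvilleField (lam.subExact g hg) x = liouvilleField lam x := by
  refine (liouvilleField_unique h.subExact x _ fun w => ?_).symm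
  rw [OneForm.d_subExact, liouvilleField_spec h, OneForm.eval_subExact]
  have h0 : g =ᶠ[𝓝 x] fun _ => 0 := notMem_tsupport_iff_eventuallyEq.1 hx
  have h1 : dReal (m := m) g x = dReal (fun _ => 0) x := h0.mfderiv_eq
  have h2 : dReal (m := m) (fun _ : M => (0 : ℝ)) x = 0 := mfderiv_const
  rw [h1, h2]
  simp

end Perturbation

end

/-! ### Comparing the flows of `nu` and `nu - dg` -/

section

section Invariance

variable {m : ℕ} {M : Type*} [TopologicalSpace M]
  [ChartedSpace (EuclideanSpace ℝ (Fin m)) M]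

theorem isMIntegralCurveOn_congr {γ : ℝ → M} {X Y : ∀ x : M, TangentSpace (𝓡 m) x} {s : Set ℝ}
    (h : IsMIntegralCurveOn (I := 𝓡 m) γ X s) (hXY : ∀ t ∈ s, X (γ t) = Y (γ t)) :
    IsMIntegralCurveOn (I := 𝓡 m) γ Y s := fun t ht => by
  rw [← hXY t ht]
  exact h t ht

variable [IsManifold (𝓡 m) ∞ M]

/-- Local flows have a uniform lifetime near each point; on a compact set finitely many lifetimes
matter. -/
theorem exists_flowRel_of_isCompact {lam : OneForm m M} (h : IsExactSymplectic lam) {K : Set M}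
    (hK : IsCompact K) : ∃ ε > 0, ∀ x ∈ K, ∃ y, FlowRel lam ε x y := by
  refine hK.induction_on (p := fun s => ∃ ε > 0, ∀ x ∈ s, ∃ y, FlowRel lam ε x y)
    ⟨1, one_pos, by simp⟩ ?_ ?_ ?_
  · rintro s t hst ⟨ε, hε, ht⟩
    exact ⟨ε, hε, fun x hx => ht x (hst hx)⟩
  · rintro s t ⟨ε, hε, hs⟩ ⟨δ, hδ, ht⟩
    have h0 : 0 < min ε δ := lt_min hε hδ
    refine ⟨min ε δ, h0, ?_⟩
    rintro x (hx | hx)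
    · obtain ⟨y, hy⟩ := hs x hx
      obtain ⟨γ, a, b, h0', ht, hγ, rfl, rfl⟩ := hy
      exact ⟨γ (min ε δ), γ, a, b, h0', ⟨by linarith [h0'.1], (min_le_left ..).trans_lt ht.2⟩, hγ,
        rfl, rfl⟩
    · obtain ⟨y, hy⟩ := ht x hx
      obtain ⟨γ, a, b, h0', ht, hγ, rfl, rfl⟩ := hy
      exact ⟨γ (min ε δ), γ, a, b, h0', ⟨by linarith [h0'.1], (min_le_right ..).trans_lt ht.2⟩, hγ,
        rfl, rfl⟩
  · intro x _
    obtain ⟨ε, hε, N, hN, hx, φ, hφ⟩ := exists_local_flow h x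
    refine ⟨N, mem_nhdsWithin_of_mem_nhds (hN.mem_nhds hx), ε / 2, half_pos hε, fun z hz =>
      ⟨φ (ε / 2) z, fun t => φ t z, -ε, ε, by simpa using hε, ⟨by linarith, by linarith⟩,
        (hφ z hz).2.1, (hφ z hz).1, rfl⟩⟩

section

variable {nu nu' : OneForm m M} {A : Set M} {T : Set M}

/-- If two Liouville fields agree off the closed set `T`, and the closed set `A` misses `T` and is
forward invariant for the first field, then the flows agree on `A`. -/
theorem FlowRel.of_subExact (h : IsExactSymplectic nu) (hA : IsClosed A) (hT : IsClosed T)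
    (hAT : Disjoint A T) (heq : ∀ x ∉ T, liouvilleField nu' x = liouvilleField nu x)
    (hinv : ∀ s ≥ 0, ∀ x ∈ A, ∀ y, FlowRel nu s x y → y ∈ A) {t : ℝ} (ht : 0 ≤ t) {x y : M}
    (hx : x ∈ A) (hxy : FlowRel nu' t x y) : FlowRel nu t x y := by
  obtain ⟨γ, a, b, h0, ht', hγ, rfl, rfl⟩ := hxy
  have hsub : Icc 0 t ⊆ Ioo a b := fun s hs => ⟨by linarith [h0.1, hs.1], by linarith [ht'.2, hs.2]⟩
  have hc : ContinuousOn γ (Ioo a b) := hγ.continuousOn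
  have key : Icc 0 t ⊆ {s | γ s ∈ A} := by
    -- Continuity method: at a time when the curve is in `A` it is off `T`, so for a short while it
    -- is also a curve of the first field, and forward invariance keeps it in `A`.
    refine IsClosed.Icc_subset_of_forall_exists_gt ?_ hx ?_
    · rw [inter_comm]
      exact (hc.mono hsub).preimage_isClosed_of_isClosed isClosed_Icc hA
    · rintro s ⟨hs, hs1⟩ r hr
      have hs2 : s ∈ Ioo a b := hsub ⟨hs1.1, hs1.2.le⟩
      have hnear : ∀ᶠ u in 𝓝 s, γ u ∉ T ∧ u ∈ Ioo a b := by
        refine ((hc.continuousAt (Ioo_mem_nhds hs2.1 hs2.2)).eventually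
          (hT.isOpen_compl.mem_nhds (disjoint_left.1 hAT hs))).and (Ioo_mem_nhds hs2.1 hs2.2)
      obtain ⟨l, u, hlu, hu⟩ := mem_nhds_iff_exists_Ioo_subset.1 hnear
      have hcurve : IsMIntegralCurveOn (I := 𝓡 m) γ (liouvilleField nu) (Ioo l u) :=
        isMIntegralCurveOn_congr (hγ.mono fun v hv => (hu hv).2)
          fun v hv => heq _ (hu hv).1
      obtain ⟨q, hq1, hq2⟩ := exists_between (lt_min hlu.2 (show s < r from hr))
      have hq3 := lt_min_iff.1 hq2
      exact ⟨q, hinv (q - s) (by linarith) _ hs _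
        (flowRel_of_curve hcurve hlu ⟨by linarith [hlu.1], hq3.1⟩), hq1, hq3.2.le⟩
  exact flowRel_of_Icc h ht (isMIntegralCurveOn_congr (hγ.mono hsub)
    fun s hs => heq _ (disjoint_left.1 hAT (key hs)))

theorem FlowRel.to_subExact (h' : IsExactSymplectic nu')
    (hAT : Disjoint A T) (heq : ∀ x ∉ T, liouvilleField nu' x = liouvilleField nu x)
    (hinv : ∀ s ≥ 0, ∀ x ∈ A, ∀ y, FlowRel nu s x y → y ∈ A) {t : ℝ} (ht : 0 ≤ t) {x y : M}
    (hx : x ∈ A) (hxy : FlowRel nu t x y) : FlowRel nu' t x y := by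
  obtain ⟨γ, a, b, h0, ht', hγ, rfl, rfl⟩ := hxy
  have hsub : Icc 0 t ⊆ Ioo a b := fun s hs => ⟨by linarith [h0.1, hs.1], by linarith [ht'.2, hs.2]⟩
  refine flowRel_of_Icc h' ht (isMIntegralCurveOn_congr (hγ.mono hsub) fun s hs => ?_)
  have h1 := flowRel_of_curve hγ h0 (hsub hs)
  rw [sub_zero] at h1
  exact (heq _ (disjoint_left.1 hAT (hinv s hs.1 _ hx _ h1))).symm

end

end Invariance

section Perturbation

variable {n : ℕ}
  {W : Type*} [TopologicalSpace W] [T2Space W] [ChartedSpace (EuclideanSpace ℝ (Fin (2 * n))) W]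
  [IsManifold (𝓡 (2 * n)) ∞ W] {nu : OneForm (2 * n) W}

/-- `Φ` is the flow of `nu - dg` for time `t` followed by the flow of `nu` for time `-t`, suitably
interpreted where the former is undefined. -/
theorem exists_flow_comp_flow (h : IsOpenLiouvilleDomain nu) {g : W → ℝ}
    (hg : ContMDiff (𝓡 (2 * n)) 𝓘(ℝ, ℝ) ∞ g) {s : ℝ} (hs : 0 < s)
    (hgs : tsupport g ⊆ flowImage nu (-s)) {t : ℝ} (ht : 0 ≤ t) :
    ∃ Φ : W → W, IsLiouvilleEmbeddingOn nu nu univ Φ ∧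
      ∀ x y z, FlowRel (nu.subExact g hg) t x z → FlowRel nu t y z → Φ x = y := by
  have hn := h.exactSymplectic
  set nu' := nu.subExact g hg with hnu'
  have hn' : IsExactSymplectic nu' := hn.subExact
  set O := flowImage nu (-s) with hO
  have hOo : IsOpen O := isOpen_flowImage hn hs.le
  have hA : IsClosed Oᶜ := hOo.isClosed_compl
  have hAT : Disjoint Oᶜ (tsupport g) := (disjoint_compl_left_iff_subset).2 hgs
  have heq : ∀ x ∉ tsupport g, liouvilleField nu' x = liouvilleField nu x := fun x hx =>
    liouvilleField_subExact hn hx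
  have hinv : ∀ r ≥ 0, ∀ x ∈ Oᶜ, ∀ y, FlowRel nu r x y → y ∈ Oᶜ := by
    intro r hr x hx y hxy hy
    exact hx (flowImage_subset hn hs.le (by linarith) ((hxy.mem_flowImage_iff hn hr hs.le).2 hy))
  have hBA : (closure O)ᶜ ⊆ Oᶜ := compl_subset_compl.2 subset_closure
  -- `R x τ z y`: follow `nu - dg` from `x` to `z` until the stopping time `τ`, then follow `nu`
  -- back to `y`. Stopping before `t` requires leaving the closure of `O`, not merely `O`: this is
  -- an open condition, so the same `τ` serves all nearby points.
  let R : W → ℝ → W → W → Prop := fun x τ z y => τ ∈ Icc 0 t ∧ FlowRel nu' τ x z ∧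
    (τ = t ∨ z ∈ (closure O)ᶜ) ∧ FlowRel nu τ y z
  have hex : ∀ x, ∃ τ z y, R x τ z y := by
    obtain ⟨ε, hε, hK⟩ := exists_flowRel_of_isCompact hn' (isCompact_closure_flowImage h hs)
    -- On the compact closure of `O` the flow of `nu - dg` lasts at least `ε`, so each step either
    -- gains `ε` or has already reached the outside.
    have hstep : ∀ (k : ℕ) (x : W), ∃ τ ≥ 0, ∃ z, FlowRel nu' τ x z ∧
        (k * ε ≤ τ ∨ z ∈ (closure O)ᶜ) := by
      intro k x
      induction k with
      | zero => exact ⟨0, le_rfl, x, FlowRel.refl hn' x, Or.inl (by simp)⟩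
      | succ k ih =>
        obtain ⟨τ, hτ, z, hz, h1⟩ := ih
        by_cases hzB : z ∈ closure O
        · obtain ⟨w, hw⟩ := hK z hzB
          refine ⟨τ + ε, by positivity, w, hz.trans hn' hw, Or.inl ?_⟩
          have := h1.resolve_right fun h => h hzB
          push_cast
          linarith
        · exact ⟨τ, hτ, z, hz, Or.inr hzB⟩
    intro x
    obtain ⟨k, hk⟩ := exists_nat_gt (t / ε)
    rw [div_lt_iff₀ hε] at hk
    obtain ⟨τ, hτ, z, hz, h1⟩ := hstep k x
    rcases le_or_gt t τ with h2 | h2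
    · obtain ⟨z', hz'⟩ := hz.exists_of_le ht h2
      obtain ⟨y, hy⟩ := h.exists_flowRel ht z'
      exact ⟨t, z', y, ⟨ht, le_rfl⟩, hz', Or.inl rfl, hy⟩
    · obtain ⟨y, hy⟩ := h.exists_flowRel hτ z
      exact ⟨τ, z, y, ⟨hτ, h2.le⟩, hz, Or.inr (h1.resolve_left (by linarith)), hy⟩
  -- Between two admissible stopping times the orbit stays where the fields agree, so the extra
  -- forward and backward motions cancel. The primitive is unaffected because `g` vanishes there.
  have huniq' : ∀ x τ z y τ' z' y', τ ≤ τ' → R x τ z y → R x τ' z' y' →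
      y = y' ∧ Real.exp (-τ) * g z = Real.exp (-τ') * g z' := by
    rintro x τ z y τ' z' y' hle ⟨a1, a2, a3, a4⟩ ⟨b1, b2, b3, b4⟩
    rcases eq_or_lt_of_le hle with rfl | hlt
    · obtain rfl := a2.unique hn' b2
      exact ⟨a4.unique_left hn b4, rfl⟩
    · have hz := hBA (a3.resolve_left (hlt.trans_le b1.2).ne)
      have h1 : FlowRel nu' (τ' - τ) z z' := by
        simpa [neg_add_eq_sub] using a2.symm.trans hn' b2
      have h2 := h1.of_subExact hn hA (isClosed_tsupport g) hAT heq hinv (by linarith) hz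
      have hz' := hinv _ (by linarith) _ hz _ h2
      refine ⟨?_, ?_⟩
      · have := a4.trans hn h2
        rw [add_sub_cancel] at this
        exact this.unique_left hn b4
      · rw [image_eq_zero_of_notMem_tsupport (disjoint_left.1 hAT hz),
          image_eq_zero_of_notMem_tsupport (disjoint_left.1 hAT hz'), mul_zero, mul_zero]
  have huniq : ∀ x τ z y τ' z' y', R x τ z y → R x τ' z' y' →
      y = y' ∧ Real.exp (-τ) * g z = Real.exp (-τ') * g z' := by
    intro x τ z y τ' z' y' h1 h2
    rcases le_total τ τ' with hle | hle
    · exact huniq' _ _ _ _ _ _ _ hle h1 h2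
    · obtain ⟨e1, e2⟩ := huniq' _ _ _ _ _ _ _ hle h2 h1
      exact ⟨e1.symm, e2.symm⟩
  have hinj' : ∀ x x' τ z y τ' z', τ ≤ τ' → R x τ z y → R x' τ' z' y → x = x' := by
    rintro x x' τ z y τ' z' hle ⟨a1, a2, a3, a4⟩ ⟨b1, b2, b3, b4⟩
    rcases eq_or_lt_of_le hle with rfl | hlt
    · obtain rfl := a4.unique hn b4
      exact a2.unique_left hn' b2
    · have hz := hBA (a3.resolve_left (hlt.trans_le b1.2).ne)
      have h1 : FlowRel nu (τ' - τ) z z' := by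
        simpa [neg_add_eq_sub] using a4.symm.trans hn b4
      have h2 := a2.trans hn' (h1.to_subExact hn' hAT heq hinv (by linarith) hz)
      rw [add_sub_cancel] at h2
      exact h2.unique_left hn' b2
  choose τ z Φ hR using hex
  refine ⟨Φ, ?_, fun x y w h1 h2 =>
    (huniq x _ _ _ t w y (hR x) ⟨⟨ht, le_rfl⟩, h1, Or.inl rfl, h2⟩).1⟩
  -- The second flow must act on `nu`, not on `nu - dg`. So `Φ` is the conjugate of the identity,
  -- seen as an exact map from `nu - dg` to `nu`; the change back at the source is `hid'`.
  have hid : PullsBackOn nu' nu univ id g := by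
    refine fun x _ => ⟨contMDiffAt_id, hg x, fun v => ?_⟩
    rw [mfderiv_id, OneForm.eval_subExact]
    exact sub_sub_cancel _ _
  have hid' : PullsBackOn nu nu' univ id (fun x => -1 * g x) := by
    refine fun x _ => ⟨contMDiffAt_id, contMDiffAt_const.mul (hg x), fun v => ?_⟩
    rw [mfderiv_id, dReal_const_mul (hg x)]
    refine (congrArg (· - nu.eval x v) (OneForm.eval_subExact (hg := hg) x v)).trans ?_
    ring
  have hmain : PullsBackOn nu' nu univ Φ (fun x => Real.exp (-τ x) * g (z x)) := by
    intro x _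
    obtain ⟨a1, a2, a3, a4⟩ := hR x
    obtain ⟨φ, hφ, hφg⟩ := a2.exists_germ hn'
    obtain ⟨ψ, hψ, hψg⟩ := a4.symm.exists_germ hn
    rw [← hφ] at hψg a3
    have h1 := PullsBackOn.conj_flow (F := id) hφg (hid.mono (subset_univ _)) hψg
    have hc := hφg.self_of_nhds.1.continuousAt
    have hB : ∀ᶠ u in 𝓝 x, τ x = t ∨ φ u ∈ (closure O)ᶜ := by
      rcases a3 with a3 | a3
      · exact Eventually.of_forall fun _ => Or.inl a3
      · exact (hc.eventually (isClosed_closure.isOpen_compl.mem_nhds a3)).mono fun u hu => Or.inr hu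
    have hloc : ∀ᶠ u in 𝓝 x, R u (τ x) (φ u) (ψ (φ u)) := by
      filter_upwards [hφg, hc.eventually hψg, hB] with u hu1 hu2 hu3
      refine ⟨a1, hu1.2.1, hu3, ?_⟩
      simpa using hu2.2.1.symm
    refine h1.congr ?_ ?_ x rfl
    · filter_upwards [hloc] with u hu
      exact (huniq _ _ _ _ _ _ _ (hR u) hu).1
    · filter_upwards [hloc] with u hu
      exact (huniq _ _ _ _ _ _ _ (hR u) hu).2
  refine ((hmain.comp hid' (mapsTo_univ _ _))).isLiouvilleEmbeddingOn hn isOpen_univ ?_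
  intro x _ x' _ e
  have e' : Φ x = Φ x' := e
  have h2 := hR x'
  rw [← e'] at h2
  rcases le_total (τ x) (τ x') with hle | hle
  · exact hinj' _ _ _ _ _ _ _ hle (hR x) h2
  · exact (hinj' _ _ _ _ _ _ _ hle h2 (hR x)).symm

end Perturbation

end

/-! ### Correcting an embedding so that it covers deeper scalings -/

section

theorem exists_contMDiff_extension {m : ℕ} {M : Type*} [TopologicalSpace M] [T2Space M]
    [SecondCountableTopology M] [ChartedSpace (EuclideanSpace ℝ (Fin m)) M]
    [IsManifold (𝓡 m) ∞ M] {Q O : Set M} (hQ : IsCompact Q) (hO : IsOpen O) (hQO : Q ⊆ O)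
    {G : M → ℝ} (hG : ∀ x ∈ O, ContMDiffAt (𝓡 m) 𝓘(ℝ, ℝ) ∞ G x) :
    ∃ g : M → ℝ, ContMDiff (𝓡 m) 𝓘(ℝ, ℝ) ∞ g ∧ IsCompact (tsupport g) ∧
      ∀ x ∈ Q, g =ᶠ[𝓝 x] G := by
  have : LocallyCompactSpace M := Manifold.locallyCompact_of_finiteDimensional (𝓡 m)
  obtain ⟨L, hL, hQL, hLO⟩ := exists_compact_between hQ hO hQO
  obtain ⟨β, hβ1, hβ0, -⟩ := exists_contMDiffMap_one_nhds_of_subset_interior (n := ⊤) (𝓡 m)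
    hQ.isClosed hQL
  have hsupp : tsupport (fun x => β x * G x) ⊆ L := by
    refine closure_minimal (fun x hx => ?_) hL.isClosed
    by_contra hxL
    exact hx (by simp [hβ0 x hxL])
  refine ⟨fun x => β x * G x, fun x => ?_, hL.of_isClosed_subset (isClosed_tsupport _) hsupp,
    fun x hx => ?_⟩
  · by_cases hx : x ∈ O
    · exact (β.contMDiff x).mul (hG x hx)
    · exact contMDiffAt_const.congr_of_eventuallyEq
        (notMem_tsupport_iff_eventuallyEq.1 fun h => hx (hLO (hsupp h)))
  · filter_upwards [eventually_nhdsSet_iff_forall.1 hβ1 x hx] with z hz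
    rw [hz, one_mul]

section Exhaustion

variable {m : ℕ} {M : Type*} [TopologicalSpace M] [T2Space M]
  [ChartedSpace (EuclideanSpace ℝ (Fin m)) M] [IsManifold (𝓡 m) ∞ M] {lam : OneForm m M}

/-- The scalings at levels `σ + η` exhaust the one at level `σ` as `η` decreases to zero. Their
images form an increasing open cover of `K`, so one of them suffices. -/
theorem exists_subset_image_flowImage_add (h : IsExactSymplectic lam) {X : Type*}
    [TopologicalSpace X] {k : M → X} {σ : ℝ} (hσ : 0 ≤ σ)
    (hk : ∀ S ⊆ flowImage lam (-σ), IsOpen S → IsOpen (k '' S)) {K : Set X} (hK : IsCompact K)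
    (hKS : K ⊆ k '' flowImage lam (-σ)) : ∃ η > 0, K ⊆ k '' flowImage lam (-(σ + η)) := by
  have : Nonempty (Ioi (0 : ℝ)) := ⟨⟨1, mem_Ioi.2 one_pos⟩⟩
  have hopen : ∀ η : Ioi (0 : ℝ), IsOpen (k '' flowImage lam (-(σ + η))) := by
    rintro ⟨η, hη : 0 < η⟩
    exact hk _ (flowImage_subset h hσ (by simpa using hη.le)) (isOpen_flowImage h (by positivity))
  have hcover : K ⊆ ⋃ η : Ioi (0 : ℝ), k '' flowImage lam (-(σ + η)) := by
    intro x hx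
    obtain ⟨y, hy, rfl⟩ := hKS hx
    obtain ⟨η, hη, hyη⟩ := exists_mem_flowImage_add h hσ hy
    exact mem_iUnion.2 ⟨⟨η, hη⟩, y, hyη, rfl⟩
  have hmono : ∀ η δ : ℝ, 0 < η → η ≤ δ →
      k '' flowImage lam (-(σ + δ)) ⊆ k '' flowImage lam (-(σ + η)) := fun η δ hη hηδ =>
    image_mono (flowImage_subset h (by positivity) (by linarith))
  obtain ⟨⟨η, hη⟩, hKη⟩ := hK.elim_directed_cover _ hopen hcover fun η δ =>
    ⟨⟨min η δ, mem_Ioi.2 (lt_min η.2 δ.2)⟩, hmono _ _ (lt_min η.2 δ.2) (min_le_left ..),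
      hmono _ _ (lt_min η.2 δ.2) (min_le_right ..)⟩
  exact ⟨η, hη, hKη⟩

end Exhaustion

section Extension

variable {n : ℕ}
  {V : Type*} [TopologicalSpace V] [ChartedSpace (EuclideanSpace ℝ (Fin (2 * n))) V]
  [IsManifold (𝓡 (2 * n)) ∞ V]
  {W : Type*} [TopologicalSpace W] [ChartedSpace (EuclideanSpace ℝ (Fin (2 * n))) W]
  [IsManifold (𝓡 (2 * n)) ∞ W] {mu : OneForm (2 * n) V} {nu : OneForm (2 * n) W}

theorem PullsBackOn.isOpen_image (h : IsExactSymplectic mu) {S : Set V} (hS : IsOpen S)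
    {k : V → W} {F : V → ℝ} (hk : PullsBackOn mu nu S k F) {S' : Set V} (hS' : S' ⊆ S)
    (hS'o : IsOpen S') : IsOpen (k '' S') := by
  rw [isOpen_iff_mem_nhds]
  rintro _ ⟨x, hx, rfl⟩
  exact nhds_le_map_of_localInverse (hk x (hS' hx)).1 (hk.injective_mfderiv h hS (hS' hx))
    (image_mem_map (hS'o.mem_nhds hx))

theorem PullsBackOn.contMDiffAt_inverse (h : IsExactSymplectic mu) {S : Set V} (hS : IsOpen S)
    {k : V → W} {F : V → ℝ} (hk : PullsBackOn mu nu S k F) {κ : W → V}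
    (hκ : ∀ x ∈ S, κ (k x) = x) {x : V} (hx : x ∈ S) :
    ContMDiffAt (𝓡 (2 * n)) (𝓡 (2 * n)) ∞ κ (k x) := by
  obtain ⟨j, hj, hj0, hjr, -⟩ :=
    exists_localInverse (hk x hx).1 (hk.injective_mfderiv h hS hx)
  refine hj.congr_of_eventuallyEq ?_
  have hjS : ∀ᶠ w in 𝓝 (k x), j w ∈ S :=
    hj.continuousAt.eventually (hS.mem_nhds (by rwa [hj0]))
  filter_upwards [hjr, hjS] with w hw hw'
  rw [← hκ _ hw', hw]

/-- If `g = F` along `k`, then `k` maps the Liouville field of `mu` to that of `nu - dg`. -/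
theorem PullsBackOn.mfderiv_liouvilleField (h : IsExactSymplectic mu) (h' : IsExactSymplectic nu)
    {S : Set V} (hS : IsOpen S) {k : V → W} {F : V → ℝ} (hk : PullsBackOn mu nu S k F)
    {g : W → ℝ} (hg : ContMDiff (𝓡 (2 * n)) 𝓘(ℝ, ℝ) ∞ g) {x : V} (hx : x ∈ S)
    (hgF : (fun y => g (k y)) =ᶠ[𝓝 x] F) :
    mfderiv (𝓡 (2 * n)) (𝓡 (2 * n)) k x (liouvilleField mu x) =
      liouvilleField (nu.subExact g hg) (k x) := by
  refine liouvilleField_unique h'.subExact _ _ fun w => ?_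
  have hsurj : Function.Surjective (mfderiv (𝓡 (2 * n)) (𝓡 (2 * n)) k x) := by
    let T : EuclideanSpace ℝ (Fin (2 * n)) →L[ℝ] EuclideanSpace ℝ (Fin (2 * n)) :=
      mfderiv (𝓡 (2 * n)) (𝓡 (2 * n)) k x
    exact (LinearMap.injective_iff_surjective (f := T.toLinearMap)).1 (hk.injective_mfderiv h hS hx)
  obtain ⟨u, rfl⟩ := hsurj w
  have e : dReal (m := 2 * n) (fun y => g (k y)) x = dReal F x := hgF.mfderiv_eq
  rw [OneForm.d_subExact, hk.d_eq hS hx, liouvilleField_spec h, OneForm.eval_subExact,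
    ← dReal_comp (hg _) (hk x hx).1, e, ← (hk x hx).2.2]
  ring

variable [T2Space V] [T2Space W] [SecondCountableTopology W]

/-- Composing `k` with the map of `exists_flow_comp_flow` makes it commute with the backward flows
on a slightly smaller domain, so a covering at levels `ρ`, `σ` passes to `ρ + t`, `σ + t` with loss
`ε`. -/
theorem IsLiouvilleEmbeddingOn.exists_extension (h : IsOpenLiouvilleDomain mu)
    (h' : IsOpenLiouvilleDomain nu) {σ ρ t ε : ℝ} (hσ : 0 ≤ σ) (hρ : 0 ≤ ρ) (ht : 0 ≤ t)
    (hε : 0 < ε) {k : V → W} (hk : IsLiouvilleEmbeddingOn mu nu (flowImage mu (-σ)) k)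
    (hρk : flowImage nu (-ρ) ⊆ k '' flowImage mu (-σ)) :
    ∃ k' : V → W, IsLiouvilleEmbeddingOn mu nu (flowImage mu (-σ)) k' ∧
      flowImage nu (-(ρ + t + ε)) ⊆ k' '' flowImage mu (-(σ + t)) := by
  have hm := h.exactSymplectic
  have hn := h'.exactSymplectic
  have hS : IsOpen (flowImage mu (-σ)) := isOpen_flowImage hm hσ
  have hinj := hk.injOn
  obtain ⟨F, hF⟩ := hk.pullsBackOn hS
  rcases isEmpty_or_nonempty V with hV | hV
  · refine ⟨k, hk, fun y hy => ?_⟩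
    obtain ⟨x, -, -⟩ := hρk (flowImage_subset hn hρ (by linarith) hy)
    exact hV.elim x
  -- The `ε` makes the set to be covered relatively compact, which leaves room `η` in the domain.
  -- The transported primitive then has to be matched only near the compact set `k '' closure
  -- (flowImage mu (-(σ + η)))`.
  obtain ⟨η, hη, hKη⟩ := exists_subset_image_flowImage_add hm hσ
    (fun S' hS' hS'o => hF.isOpen_image hm hS hS' hS'o)
    (isCompact_closure_flowImage h' (show 0 < ρ + ε by linarith))
    ((closure_flowImage_subset h' hρ hε).trans hρk)
  have hcl := closure_flowImage_subset h hσ hη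
  have hQ : IsCompact (k '' closure (flowImage mu (-(σ + η)))) :=
    (isCompact_closure_flowImage h (by linarith)).image_of_continuousOn
      fun x hx => (hF x (hcl hx)).1.continuousAt.continuousWithinAt
  set κ := Function.invFunOn k (flowImage mu (-σ)) with hκ_def
  have hκ : ∀ x ∈ flowImage mu (-σ), κ (k x) = x := fun x hx => hinj.leftInvOn_invFunOn hx
  obtain ⟨g, hg, hgc, hgQ⟩ := exists_contMDiff_extension (m := 2 * n) (G := fun w => F (κ w)) hQ
    (hF.isOpen_image hm hS Subset.rfl hS) (image_mono hcl) (by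
      rintro _ ⟨x, hx, rfl⟩
      exact ContMDiffAt.comp_of_eq (hF x hx).2.1 (hF.contMDiffAt_inverse hm hS hκ hx)
        (hκ x hx))
  -- A compact set, here the support of `g`, lies in some proper scaling of `W`.
  obtain ⟨s, hs, hgs⟩ := exists_subset_image_flowImage_add (k := id) hn le_rfl
    (fun S' _ hS'o => by rwa [image_id]) hgc (by rw [flowImage_zero hn]; simp)
  rw [image_id, zero_add] at hgs
  obtain ⟨Φ, hΦ, hΦt⟩ := exists_flow_comp_flow h' hg hs hgs ht
  refine ⟨Φ ∘ k, IsLiouvilleEmbeddingOn.comp hm hS isOpen_univ hΦ hk (mapsTo_univ _ _), ?_⟩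
  intro y hy
  obtain ⟨w, hw⟩ := (mem_flowImage_iff hn (by linarith)).1 hy
  obtain ⟨z, hz⟩ := hw.exists_of_le ht (by linarith)
  have hzK : z ∈ flowImage nu (-(ρ + ε)) := by
    rw [← hz.mem_flowImage_iff hn ht (by linarith)]
    convert hy using 2
    ring
  obtain ⟨p, hp, rfl⟩ := hKη (subset_closure hzK)
  obtain ⟨x, hx⟩ := h.exists_flowRel ht p
  have hxS : x ∈ flowImage mu (-(σ + η + t)) := (hx.mem_flowImage_iff hm ht (by linarith)).2 hp
  -- It remains to see that `k` carries the `mu`-orbit from `x` to `p` to an orbit of `nu - dg`.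
  -- This orbit stays at level `σ + η`, where `g` matches the primitive.
  refine ⟨x, flowImage_subset hm (by linarith) (by linarith) hxS, hΦt _ _ _ ?_ hz⟩
  obtain ⟨γ, a, b, h0, ht', hγ, rfl, rfl⟩ := hx
  refine flowRel_of_Icc (γ := k ∘ γ) hn.subExact ht fun r hr => ?_
  have hrI : r ∈ Ioo a b := ⟨by linarith [h0.1, hr.1], by linarith [ht'.2, hr.2]⟩
  have hrS : γ r ∈ flowImage mu (-(σ + η)) := by
    have h1 := flowRel_of_curve hγ h0 hrI
    rw [sub_zero] at h1
    rw [← h1.mem_flowImage_iff hm hr.1 (by linarith)]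
    exact flowImage_subset hm (by linarith [hr.1]) (by linarith [hr.2]) hxS
  have hrT : γ r ∈ flowImage mu (-σ) := hcl (subset_closure hrS)
  have hgF : (fun y => g (k y)) =ᶠ[𝓝 (γ r)] F := by
    filter_upwards [(hF _ hrT).1.continuousAt.eventually
      (hgQ _ ⟨_, subset_closure hrS, rfl⟩), hS.mem_nhds hrT] with v hv hv'
    rw [hv, hκ v hv']
  have e := hF.mfderiv_liouvilleField hm hn hS hg hrT hgF
  have h2 := ((hF _ hrT).1.mdifferentiableAt (by simp)).hasMFDerivAt.comp_hasMFDerivWithinAt r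
    ((hγ r hrI).mono (s := Icc 0 t) fun u hu =>
      ⟨by linarith [h0.1, hu.1], by linarith [ht'.2, hu.2]⟩)
  refine h2.congr_mfderiv ?_
  refine ContinuousLinearMap.ext_ring ?_
  change mfderiv (𝓡 (2 * n)) (𝓡 (2 * n)) k (γ r) ((1 : ℝ) • liouvilleField mu (γ r)) =
    (1 : ℝ) • liouvilleField (nu.subExact g hg) (k (γ r))
  rw [one_smul, one_smul, e]

end Extension

end

/-! ### Submultiplicativity of the distances -/

section

/-- The infima are taken one at a time by division. The lower bound `1` excludes division by zero
and the product of `0` and `⊤`. -/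
theorem sInf_le_sInf_mul_sInf {R S T : Set ℝ≥0∞} (hS : ∀ s ∈ S, 1 ≤ s) (hT : ∀ t ∈ T, 1 ≤ t)
    (hT' : ∀ t ∈ T, t ≠ ⊤) (h : ∀ s ∈ S, ∀ t ∈ T, sInf R ≤ s * t) :
    sInf R ≤ sInf S * sInf T := by
  have hS1 : 1 ≤ sInf S := le_sInf hS
  have hT1 : 1 ≤ sInf T := le_sInf hT
  have h1 : ∀ t ∈ T, sInf R ≤ sInf S * t := by
    intro t ht
    have ht0 : t ≠ 0 := (one_pos.trans_le (hT t ht)).ne'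
    rw [← ENNReal.div_le_iff ht0 (hT' t ht)]
    exact le_sInf fun s hs => (ENNReal.div_le_iff ht0 (hT' t ht)).2 (h s hs t ht)
  by_cases htop : sInf S = ⊤
  · rw [htop, ENNReal.top_mul (one_pos.trans_le hT1).ne']
    exact le_top
  · have hS0 : sInf S ≠ 0 := (one_pos.trans_le hS1).ne'
    rw [mul_comm, ← ENNReal.div_le_iff hS0 htop]
    exact le_sInf fun t ht => (ENNReal.div_le_iff hS0 htop).2 (by rw [mul_comm]; exact h1 t ht)

section Scaling

variable {m : ℕ} {M : Type*} [TopologicalSpace M]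
  [ChartedSpace (EuclideanSpace ℝ (Fin m)) M] [IsManifold (𝓡 m) ∞ M] (lam : OneForm m M)

theorem scaling_rpow {a : ℝ} (ha : 1 ≤ a) :
    scaling (a ^ (-1 / 2 : ℝ)) lam = flowImage lam (-(Real.log a / 2)) := by
  rw [scaling, Real.log_rpow (by linarith)]
  congr 1
  ring

theorem scaling_inv (a : ℝ) : scaling a⁻¹ lam = flowImage lam (-Real.log a) := by
  rw [scaling, Real.log_inv]

end Scaling

variable {n : ℕ}
  {U : Type*} [TopologicalSpace U] [T2Space U]
  [ChartedSpace (EuclideanSpace ℝ (Fin (2 * n))) U] [IsManifold (𝓡 (2 * n)) ∞ U]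
  {V : Type*} [TopologicalSpace V] [T2Space V]
  [ChartedSpace (EuclideanSpace ℝ (Fin (2 * n))) V] [IsManifold (𝓡 (2 * n)) ∞ V]
  {W : Type*} [TopologicalSpace W]
  [ChartedSpace (EuclideanSpace ℝ (Fin (2 * n))) W] [IsManifold (𝓡 (2 * n)) ∞ W]
  {lam : OneForm (2 * n) U} {mu : OneForm (2 * n) V} {nu : OneForm (2 * n) W}

/-- Pushing an embedding into a smaller scaling of the target by conjugation with the flows. -/
theorem IsLiouvilleEmbeddingOn.exists_shrink (hU : IsOpenLiouvilleDomain lam)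
    (hV : IsOpenLiouvilleDomain mu) {σ s : ℝ} (hσ : 0 ≤ σ) (hs : 0 ≤ s) {F : U → V}
    (hF : IsLiouvilleEmbeddingOn lam mu (flowImage lam (-σ)) F) :
    ∃ G : U → V, IsLiouvilleEmbeddingOn lam mu (flowImage lam (-(σ + s))) G ∧
      MapsTo G (flowImage lam (-(σ + s))) (flowImage mu (-s)) ∧
      ∀ ρ ≥ 0, flowImage mu (-ρ) ⊆ F '' flowImage lam (-σ) →
        flowImage mu (-(ρ + s)) ⊆ G '' flowImage lam (-(σ + s)) := by
  have hl := hU.exactSymplectic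
  have hm := hV.exactSymplectic
  obtain ⟨G, hG, hGF⟩ := hF.exists_conj_flow hl hV hσ hs
  refine ⟨G, hG, fun x hx => ?_, fun ρ hρ hsub p hp => ?_⟩
  · obtain ⟨w, hw⟩ := (mem_flowImage_iff hl (by positivity)).1 hx
    obtain ⟨y, hy⟩ := hw.exists_of_le hs (by linarith)
    exact (mem_flowImage_iff hm hs).2
      ⟨_, hGF x y ((hy.mem_flowImage_iff hl hs hσ).1 hx) hy⟩
  · obtain ⟨w, hw⟩ := (mem_flowImage_iff hm (by positivity)).1 hp
    obtain ⟨q, hq⟩ := hw.exists_of_le hs (by linarith)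
    obtain ⟨y, hy, rfl⟩ := hsub ((hq.mem_flowImage_iff hm hs hρ).1 hp)
    obtain ⟨x, hx⟩ := hU.exists_flowRel hs y
    exact ⟨x, (hx.mem_flowImage_iff hl hs hσ).2 hy, (hGF x y hy hx).unique_left hm hq⟩

theorem IsLiouvilleEmbeddingOn.exists_comp (hU : IsOpenLiouvilleDomain lam)
    (hV : IsOpenLiouvilleDomain mu) {σ s : ℝ} (hσ : 0 ≤ σ) (hs : 0 ≤ s) {F : U → V} {K : V → W}
    (hF : IsLiouvilleEmbeddingOn lam mu (flowImage lam (-σ)) F)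
    (hK : IsLiouvilleEmbeddingOn mu nu (flowImage mu (-s)) K) :
    ∃ G : U → W, IsLiouvilleEmbeddingOn lam nu (flowImage lam (-(σ + s))) G := by
  obtain ⟨G, hG, hmaps, -⟩ := hF.exists_shrink hU hV hσ hs
  exact ⟨K ∘ G, hK.comp hU.exactSymplectic (isOpen_flowImage hU.exactSymplectic (by positivity))
    (isOpen_flowImage hV.exactSymplectic hs) hG hmaps⟩

variable [T2Space W]

theorem coarseDist_le_mul (hU : IsOpenLiouvilleDomain lam) (hV : IsOpenLiouvilleDomain mu)
    (hW : IsOpenLiouvilleDomain nu) :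
    coarseDist lam nu ≤ coarseDist lam mu * coarseDist mu nu := by
  refine sInf_le_sInf_mul_sInf ?_ ?_ ?_ ?_
  · rintro _ ⟨a, ha, rfl, -⟩
    exact ENNReal.one_le_ofReal.2 ha
  · rintro _ ⟨a, ha, rfl, -⟩
    exact ENNReal.one_le_ofReal.2 ha
  · rintro _ ⟨a, ha, rfl, -⟩
    exact ENNReal.ofReal_ne_top
  · rintro _ ⟨a, ha, rfl, ⟨F, hF⟩, ⟨F', hF'⟩⟩ _ ⟨b, hb, rfl, ⟨K, hK⟩, ⟨K', hK'⟩⟩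
    have hab : 1 ≤ a * b := one_le_mul_of_one_le_of_one_le ha hb
    have hla := Real.log_nonneg ha
    have hlb := Real.log_nonneg hb
    rw [scaling_rpow _ ha] at hF hF'
    rw [scaling_rpow _ hb] at hK hK'
    have hlog : Real.log (a * b) / 2 = Real.log a / 2 + Real.log b / 2 := by
      rw [Real.log_mul (by linarith) (by linarith)]
      ring
    refine sInf_le ⟨a * b, hab, (ENNReal.ofReal_mul (by linarith)).symm, ?_, ?_⟩
    · rw [scaling_rpow _ hab, hlog]
      exact hF.exists_comp hU hV (by positivity) (by positivity) hK
    · rw [scaling_rpow _ hab, hlog, add_comm]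
      exact hK'.exists_comp hW hV (by positivity) (by positivity) hF'

/-- The first embedding is conjugated by `β + ε`, so that it lands in the domain of the second and
covers level `2 * α + β + ε`. The second is corrected with `t = 2 * α + ε`, so that it covers level
`2 * (α + β + ε)` already from there. -/
theorem exists_embedding_of_fine [SecondCountableTopology W] (hU : IsOpenLiouvilleDomain lam)
    (hV : IsOpenLiouvilleDomain mu) (hW : IsOpenLiouvilleDomain nu) {α β ε : ℝ} (hα : 0 ≤ α)
    (hβ : 0 ≤ β) (hε : 0 < ε) {F : U → V} {K : V → W}
    (hF : IsLiouvilleEmbeddingOn lam mu (flowImage lam (-α)) F)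
    (hFs : flowImage mu (-(2 * α)) ⊆ F '' flowImage lam (-α))
    (hK : IsLiouvilleEmbeddingOn mu nu (flowImage mu (-β)) K)
    (hKs : flowImage nu (-(2 * β)) ⊆ K '' flowImage mu (-β)) :
    ∃ G : U → W, IsLiouvilleEmbeddingOn lam nu (flowImage lam (-(α + β + ε))) G ∧
      flowImage nu (-(2 * (α + β + ε))) ⊆ G '' flowImage lam (-(α + β + ε)) := by
  have hl := hU.exactSymplectic
  have hm := hV.exactSymplectic
  obtain ⟨F', hF', hmaps, hsub⟩ := hF.exists_shrink hU hV hα (show 0 ≤ β + ε by positivity)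
  obtain ⟨K', hK', hsub'⟩ := hK.exists_extension hV hW hβ (show 0 ≤ 2 * β by positivity)
    (show 0 ≤ 2 * α + ε by positivity) hε hKs
  rw [← add_assoc] at hF' hmaps hsub
  refine ⟨K' ∘ F', hK'.comp hl (isOpen_flowImage hl (by positivity)) (isOpen_flowImage hm hβ) hF'
    (hmaps.mono_right (flowImage_subset hm hβ (by linarith))), ?_⟩
  rw [image_comp]
  refine Subset.trans (le_of_eq ?_) (hsub'.trans (image_mono
    (Subset.trans (le_of_eq ?_) (hsub _ (by positivity) hFs))))
  · congr 1
    ring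
  · congr 1
    ring

theorem fineHemidist_le_mul [SecondCountableTopology W] (hU : IsOpenLiouvilleDomain lam)
    (hV : IsOpenLiouvilleDomain mu) (hW : IsOpenLiouvilleDomain nu) :
    fineHemidist lam nu ≤ fineHemidist lam mu * fineHemidist mu nu := by
  refine sInf_le_sInf_mul_sInf ?_ ?_ ?_ ?_
  · rintro _ ⟨a, ha, rfl, -⟩
    exact ENNReal.one_le_ofReal.2 ha
  · rintro _ ⟨a, ha, rfl, -⟩
    exact ENNReal.one_le_ofReal.2 ha
  · rintro _ ⟨a, ha, rfl, -⟩
    exact ENNReal.ofReal_ne_top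
  · rintro _ ⟨a, ha, rfl, F, hF, hFs⟩ _ ⟨b, hb, rfl, K, hK, hKs⟩
    have hla := Real.log_nonneg ha
    have hlb := Real.log_nonneg hb
    have two_half : ∀ x : ℝ, x = 2 * (x / 2) := fun x => by ring
    rw [scaling_rpow _ ha] at hF hFs
    rw [scaling_rpow _ hb] at hK hKs
    rw [scaling_inv, two_half (Real.log a)] at hFs
    rw [scaling_inv, two_half (Real.log b)] at hKs
    -- Adding `ε` to half the logarithm multiplies the constant by `exp (2 * ε)`, which tends to
    -- `1`.
    have key : ∀ ε > 0, fineHemidist lam nu ≤ ENNReal.ofReal (a * b * Real.exp (2 * ε)) := by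
      intro ε hε
      have he : 1 ≤ Real.exp (2 * ε) := Real.one_le_exp (by positivity)
      have hab : 1 ≤ a * b * Real.exp (2 * ε) :=
        one_le_mul_of_one_le_of_one_le (one_le_mul_of_one_le_of_one_le ha hb) he
      have hlog : Real.log (a * b * Real.exp (2 * ε)) =
          2 * (Real.log a / 2 + Real.log b / 2 + ε) := by
        rw [Real.log_mul (by positivity) (by positivity), Real.log_mul (by linarith) (by linarith),
          Real.log_exp]
        ring
      obtain ⟨G, hG, hGs⟩ := exists_embedding_of_fine hU hV hW (by positivity) (by positivity) hε
        hF (by simpa [mul_div_cancel_left₀] using hFs) hK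
        (by simpa [mul_div_cancel_left₀] using hKs)
      refine sInf_le ⟨_, hab, rfl, G, ?_⟩
      rw [scaling_rpow _ hab, scaling_inv, hlog, mul_div_cancel_left₀ _ two_ne_zero]
      exact ⟨hG, hGs⟩
    rw [← ENNReal.ofReal_mul (by linarith)]
    have hlim : Tendsto (fun ε : ℝ => ENNReal.ofReal (a * b * Real.exp (2 * ε))) (𝓝[>] 0)
        (𝓝 (ENNReal.ofReal (a * b))) := by
      have hc : Continuous fun ε : ℝ => ENNReal.ofReal (a * b * Real.exp (2 * ε)) :=
        ENNReal.continuous_ofReal.comp (by fun_prop)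
      have := hc.tendsto 0
      simp only [mul_zero, Real.exp_zero, mul_one] at this
      exact this.mono_left nhdsWithin_le_nhds
    exact ge_of_tendsto hlim (eventually_of_mem self_mem_nhdsWithin key)

theorem fineDist_le_mul [SecondCountableTopology U] [SecondCountableTopology W]
    (hU : IsOpenLiouvilleDomain lam) (hV : IsOpenLiouvilleDomain mu)
    (hW : IsOpenLiouvilleDomain nu) :
    fineDist lam nu ≤ fineDist lam mu * fineDist mu nu := by
  refine max_le ?_ ?_
  · exact (fineHemidist_le_mul hU hV hW).trans (mul_le_mul' (le_max_left ..) (le_max_left ..))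
  -- The reversed hemidistance passes from `W` through `V` to `U`, so the two factors appear in the
  -- opposite order.
  · rw [mul_comm]
    exact (fineHemidist_le_mul hW hV hU).trans (mul_le_mul' (le_max_right ..) (le_max_right ..))

end

end SymplecticBM

end

theorem proposition2p7 {n : ℕ}
    {U : Type*} [TopologicalSpace U] [T2Space U] [SecondCountableTopology U]
    [ChartedSpace (EuclideanSpace ℝ (Fin (2 * n))) U] [IsManifold (𝓡 (2 * n)) ∞ U]
    {V : Type*} [TopologicalSpace V] [T2Space V] [SecondCountableTopology V]
    [ChartedSpace (EuclideanSpace ℝ (Fin (2 * n))) V] [IsManifold (𝓡 (2 * n)) ∞ V]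
    {W : Type*} [TopologicalSpace W] [T2Space W] [SecondCountableTopology W]
    [ChartedSpace (EuclideanSpace ℝ (Fin (2 * n))) W] [IsManifold (𝓡 (2 * n)) ∞ W]
    (lam : SymplecticBM.OneForm (2 * n) U) (mu : SymplecticBM.OneForm (2 * n) V)
    (nu : SymplecticBM.OneForm (2 * n) W)
    (hU : SymplecticBM.IsOpenLiouvilleDomain lam) (hV : SymplecticBM.IsOpenLiouvilleDomain mu)
    (hW : SymplecticBM.IsOpenLiouvilleDomain nu) :
    SymplecticBM.coarseDist lam nu ≤
        SymplecticBM.coarseDist lam mu * SymplecticBM.coarseDist mu nu ∧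
      SymplecticBM.fineHemidist lam nu ≤
        SymplecticBM.fineHemidist lam mu * SymplecticBM.fineHemidist mu nu ∧
      SymplecticBM.fineDist lam nu ≤
        SymplecticBM.fineDist lam mu * SymplecticBM.fineDist mu nu :=
  ⟨SymplecticBM.coarseDist_le_mul hU hV hW, SymplecticBM.fineHemidist_le_mul hU hV hW,
    SymplecticBM.fineDist_le_mul hU hV hW⟩
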